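/- Let $\mathcal{M}=(M,\mathcal{C}^\infty_{\mathcal M})$ be a ($\mathbb{Z}$-)graded manifold, let $\ell\in\mathbb{Z}$, and let $(\mathcal{E},\rho,g_{\mathcal E},[\cdot,\cdot]_{\mathcal E})$ be a graded Courant algebroid of degree $\ell$ over $\mathcal{M}$. That is: $\mathcal{E}$ is a graded vector bundle over $\mathcal{M}$ with module of global sections $\Gamma_{\mathcal E}(M)$; vector bundle maps $F$ of degree $|F|$ are the $\mathcal{C}^\infty_{\mathcal M}(M)$-linear maps of degree $|F|$ between global sections, $F(f\psi)=(-1)^{|f||F|}fF(\psi)$; the anchor $\rho:\mathcal{E}\to T\mathcal{M}$ is a vector bundle map of degree $\ell$; $g_{\mathcal E}:\mathcal{E}\to\mathcal{E}^*$ is a vector bundle isomorphism of degree $\ell$ such that $\langle\psi,\psi'\rangle:=(-1)^{(|\psi|+\ell)\ell}[g_{\mathcal E}(\psi)](\psi')$ satisfies $\langle\psi,\psi'\rangle=(-1)^{(|\psi|+\ell)(|\psi'|+\ell)}\langle\psi',\psi\rangle$; the bracket $[\cdot,\cdot]_{\mathcal E}$ on $\Gamma_{\mathcal E}(M)$ is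 $\mathbb{R}$-bilinear with $|[\psi,\psi']_{\mathcal E}|=|\psi|+|\psi'|+\ell$; and, with $\hat\rho(\psi):=(-1)^{(|\psi|+\ell)\ell}\rho(\psi)$, for all homogeneous sections $$\hat\rho(\psi)\langle\psi',\psi''\rangle=\langle[\psi,\psi']_{\mathcal E},\psi''\rangle+(-1)^{(|\psi|+\ell)(|\psi'|+\ell)}\langle\psi',[\psi,\psi'']_{\mathcal E}\rangle,$$ $$[\psi,\psi']_{\mathcal E}+(-1)^{(|\psi|+\ell)(|\psi'|+\ell)}[\psi',\psi]_{\mathcal E}=(-1)^{|\psi|+|\psi'|}\,\mathrm{D}\langle\psi,\psi'\rangle,$$ $$[\psi,[\psi',\psi'']_{\mathcal E}]_{\mathcal E}=[[\psi,\psi']_{\mathcal E},\psi'']_{\mathcal E}+(-1)^{(|\psi|+\ell)(|\psi'|+\ell)}[\psi',[\psi,\psi'']_{\mathcal E}]_{\mathcal E}.$$ Here $\mathrm{D}:=\rho^*\circ\mathrm{d}:\mathcal{C}^\infty_{\mathcal M}(M)\to\Gamma_{\mathcal E}(M)$ and $\rho^*:=g_{\mathcal E}^{-1}\circ\rho^T:T^*\mathcal{M}\to\mathcal{E}$,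 where $(\mathrm{d}f)(X)=(-1)^{(|X|-1)|f|}X(f)$ for vector fields $X$ (graded derivations of $\mathcal{C}^\infty_{\mathcal M}(M)$) and $[\rho^T(\alpha)](\psi)=(-1)^{|\alpha|\ell}\alpha(\rho(\psi))$. Then for all homogeneous $\psi,\psi'\in\Gamma_{\mathcal E}(M)$ and $f\in\mathcal{C}^\infty_{\mathcal M}(M)$: 1. (graded Leibniz rule) $[\psi,f\psi']_{\mathcal E}=\hat\rho(\psi)(f)\,\psi'+(-1)^{|f|(|\psi|+\ell)}f[\psi,\psi']_{\mathcal E}$; 2. $\rho([\psi,\psi']_{\mathcal E})=[\rho(\psi),\rho(\psi')]$, the graded commutator of vector fields; 3. $\rho\circ\mathrm{D}=0$ and $\rho\circ\rho^*=0$; consequently the sequence of graded vector bundles and degree zero vector bundle maps $$0\to T^*\mathcal{M}\xrightarrow{\ \rho^*\ }\mathcal{E}\xrightarrow{\ \rho\ }T[\ell]\mathcal{M}\to 0$$ is a cochain complex, where sections of $T[\ell]\mathcal{M}$ of degree $j$ are vector fields of degree $j+\ell$, with action $f\triangleright X=(-1)^{|f|\ell}fX$; 4. $[\psi,\mathrm{D}f]_{\mathcal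 E}=(-1)^{|\psi|+|f|}\,\mathrm{D}\langle\psi,\mathrm{D}f\rangle$ and $[\mathrm{D}f,\psi]_{\mathcal E}=0$. -/

import Mathlib

open TopologicalSpace
open scoped ContDiff Manifold

universe u v w

noncomputable section

namespace GradedGeometry

/-! ## Graded algebra

A graded object is a sequence `V : ℤ → Type*` of real vector spaces; only homogeneous elements are
considered.  Operations carry a proof of the degree equation, so that no casts are needed.
The sign `(-1)^n`, `n : ℤ`, is the real number `(-1 : ℝ) ^ n`. -/

/-- Graded commutative associative unital algebras over `ℝ`. -/
class GCAlg (A : ℤ → Type v) [∀ i, AddCommGroup (A i)] [∀ i, Module ℝ (A i)] where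
  one : A 0
  mul : ∀ {i j k : ℤ}, i + j = k → A i →ₗ[ℝ] A j →ₗ[ℝ] A k
  one_mul : ∀ {i : ℤ} (h : 0 + i = i) (a : A i), mul h one a = a
  mul_one : ∀ {i : ℤ} (h : i + 0 = i) (a : A i), mul h a one = a
  mul_assoc : ∀ {i j k m n l : ℤ} (h₁ : i + j = m) (h₂ : m + k = l) (h₃ : j + k = n)
    (h₄ : i + n = l) (a : A i) (b : A j) (c : A k),
    mul h₂ (mul h₁ a b) c = mul h₄ a (mul h₃ b c)
  mul_comm : ∀ {i j k : ℤ} (h : i + j = k) (h' : j + i = k) (a : A i) (b : A j),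
    mul h a b = (-1 : ℝ) ^ (i * j) • mul h' b a

/-- Graded modules over a graded commutative algebra. -/
class GMod (A : ℤ → Type v) [∀ i, AddCommGroup (A i)] [∀ i, Module ℝ (A i)] [GCAlg A]
    (E : ℤ → Type w) [∀ i, AddCommGroup (E i)] [∀ i, Module ℝ (E i)] where
  smul : ∀ {i j k : ℤ}, i + j = k → A i →ₗ[ℝ] E j →ₗ[ℝ] E k
  one_smul : ∀ {i : ℤ} (h : 0 + i = i) (x : E i), smul h GCAlg.one x = x
  mul_smul : ∀ {i j k m n l : ℤ} (h₁ : i + j = m) (h₂ : m + k = l) (h₃ : j + k = n)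
    (h₄ : i + n = l) (a : A i) (b : A j) (x : E k),
    smul h₂ (GCAlg.mul h₁ a b) x = smul h₄ a (smul h₃ b x)

section Algebra

variable (A : ℤ → Type v) [∀ i, AddCommGroup (A i)] [∀ i, Module ℝ (A i)] [GCAlg A]

/-- The algebra as a module over itself. -/
instance selfModule : GMod A A where
  smul := GCAlg.mul
  one_smul := GCAlg.one_mul
  mul_smul := GCAlg.mul_assoc

section Hom

variable (E : ℤ → Type w) [∀ i, AddCommGroup (E i)] [∀ i, Module ℝ (E i)] [GMod A E]
variable {F : ℤ → Type u} [∀ i, AddCommGroup (F i)] [∀ i, Module ℝ (F i)] [GMod A F]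

theorem smul_left_comm {i j k m n l : ℤ} (h₁ : i + j = m) (h₂ : k + m = l) (h₃ : k + j = n)
    (h₄ : i + n = l) (a : A i) (b : A k) (x : E j) :
    GMod.smul h₂ b (GMod.smul h₁ a x)
      = (-1 : ℝ) ^ (k * i) • (GMod.smul h₄ a (GMod.smul h₃ b x) : E l) := by
  rw [← GMod.mul_smul (m := k + i) rfl (by omega),
    GCAlg.mul_comm rfl (by omega : i + k = k + i) b a, map_smul, LinearMap.smul_apply,
    GMod.mul_smul _ _ h₃ h₄]

theorem smul_reindex {i n l s t : ℤ} (x : ∀ s, n = s → E s) (hs : n = s) (ht : n = t)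
    (hs' : i + s = l) (ht' : i + t = l) (a : A i) :
    (GMod.smul hs' a (x s hs) : E l) = GMod.smul ht' a (x t ht) := by
  subst hs ht
  rfl

variable (F) in
/-- `A`-linear maps of degree `d`: families `E i → F (i + d)` of `ℝ`-linear maps with
`φ (a x) = (-1)^(|a| d) a φ(x)`. -/
def homSubmodule (d : ℤ) :
    Submodule ℝ (∀ p : {p : ℤ × ℤ // p.1 + d = p.2}, E p.1.1 →ₗ[ℝ] F p.1.2) where
  carrier := {φ | ∀ (i j k l m : ℤ) (h₁ : i + j = k) (h₂ : k + d = l) (h₃ : j + d = m)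
    (h₄ : i + m = l) (a : A i) (x : E j),
    φ ⟨(k, l), h₂⟩ (GMod.smul h₁ a x)
      = (-1 : ℝ) ^ (i * d) • (GMod.smul h₄ a (φ ⟨(j, m), h₃⟩ x) : F l)}
  add_mem' := by
    intro φ χ hφ hχ i j k l m h₁ h₂ h₃ h₄ a x
    simp only [Pi.add_apply, LinearMap.add_apply, map_add, smul_add]
    rw [hφ i j k l m h₁ h₂ h₃ h₄, hχ i j k l m h₁ h₂ h₃ h₄]
  zero_mem' := by
    intro i j k l m h₁ h₂ h₃ h₄ a x
    simp
  smul_mem' := by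
    intro c φ hφ i j k l m h₁ h₂ h₃ h₄ a x
    simp only [Pi.smul_apply, LinearMap.smul_apply, map_smul]
    rw [hφ i j k l m h₁ h₂ h₃ h₄, smul_comm]

variable (F) in
/-- The space of `A`-linear maps `E → F` of degree `d`. -/
def GHom (d : ℤ) : Type (max w u) := ↥(homSubmodule A E F d)

instance (d : ℤ) : AddCommGroup (GHom A E F d) :=
  inferInstanceAs (AddCommGroup ↥(homSubmodule A E F d))

instance (d : ℤ) : Module ℝ (GHom A E F d) :=
  inferInstanceAs (Module ℝ ↥(homSubmodule A E F d))

variable {A E}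

/-- The component `E i → F j`, `j = i + d`, of a map of degree `d`. -/
def GHom.app {d : ℤ} (φ : GHom A E F d) {i j : ℤ} (h : i + d = j) : E i →ₗ[ℝ] F j :=
  φ.1 ⟨(i, j), h⟩

theorem GHom.map_gsmul {d : ℤ} (φ : GHom A E F d) {i j k l m : ℤ} (h₁ : i + j = k)
    (h₂ : k + d = l) (h₃ : j + d = m) (h₄ : i + m = l) (a : A i) (x : E j) :
    φ.app h₂ (GMod.smul h₁ a x) = (-1 : ℝ) ^ (i * d) • (GMod.smul h₄ a (φ.app h₃ x) : F l) :=
  φ.2 i j k l m h₁ h₂ h₃ h₄ a x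

theorem GHom.ext {d : ℤ} {φ χ : GHom A E F d}
    (H : ∀ (i j : ℤ) (h : i + d = j) (x : E i), φ.app h x = χ.app h x) : φ = χ := by
  apply Subtype.ext
  funext ⟨⟨i, j⟩, h⟩
  exact LinearMap.ext (H i j h)

theorem GHom.add_app {d : ℤ} (φ χ : GHom A E F d) {i j : ℤ} (h : i + d = j) (x : E i) :
    (φ + χ).app h x = φ.app h x + χ.app h x := rfl

theorem GHom.smul_app {d : ℤ} (c : ℝ) (φ : GHom A E F d) {i j : ℤ} (h : i + d = j) (x : E i) :
    (c • φ).app h x = c • φ.app h x := rfl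

/-- Constructor for `A`-linear maps of degree `d`. -/
def GHom.mk {d : ℤ} (f : ∀ (i j : ℤ), i + d = j → E i →ₗ[ℝ] F j)
    (H : ∀ (i j k l m : ℤ) (h₁ : i + j = k) (h₂ : k + d = l) (h₃ : j + d = m)
      (h₄ : i + m = l) (a : A i) (x : E j),
      f k l h₂ (GMod.smul h₁ a x) = (-1 : ℝ) ^ (i * d) • (GMod.smul h₄ a (f j m h₃ x) : F l)) :
    GHom A E F d :=
  ⟨fun p => f p.1.1 p.1.2 p.2, H⟩

theorem GHom.mk_app {d : ℤ} (f : ∀ (i j : ℤ), i + d = j → E i →ₗ[ℝ] F j) (H) {i j : ℤ}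
    (h : i + d = j) (x : E i) : (GHom.mk (A := A) f H).app h x = f i j h x := rfl

/-- Multiplication of a map by a function, `(a φ)(x) = a φ(x)`. -/
def GHom.gsmul {i j k : ℤ} (h : i + j = k) (a : A i) (φ : GHom A E F j) : GHom A E F k :=
  GHom.mk
    (fun p q hpq => (GMod.smul (by omega : i + (p + j) = q) a).comp (φ.app rfl))
    (by
      intro p q r l m h₁ h₂ h₃ h₄ b x
      simp only [LinearMap.comp_apply]
      rw [φ.map_gsmul h₁ rfl rfl (by omega), map_smul,
        smul_left_comm A F (by omega) (by omega) (by omega : i + (q + j) = m) h₄, smul_smul,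
        ← zpow_add₀ (by norm_num), show p * j + i * p = p * k by rw [← h]; ring])

/-- The graded `A`-module of `A`-linear maps. -/
instance : GMod A (GHom A E F) where
  smul {i j k} h := LinearMap.mk₂ ℝ (fun a φ => GHom.gsmul h a φ)
    (by
      intro a b φ
      apply GHom.ext
      intro p q hpq x
      simp [GHom.gsmul, GHom.mk_app, GHom.add_app])
    (by
      intro c a φ
      apply GHom.ext
      intro p q hpq x
      simp [GHom.gsmul, GHom.mk_app, GHom.smul_app])
    (by
      intro a φ χ
      apply GHom.ext
      intro p q hpq x
      simp [GHom.gsmul, GHom.mk_app, GHom.add_app])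
    (by
      intro c a φ
      apply GHom.ext
      intro p q hpq x
      simp [GHom.gsmul, GHom.mk_app, GHom.smul_app])
  one_smul {i} h φ := by
    apply GHom.ext
    intro p q hpq x
    subst hpq
    simp [GHom.gsmul, GHom.mk_app, GMod.one_smul]
  mul_smul h₁ h₂ h₃ h₄ a b φ := by
    apply GHom.ext
    intro p q hpq x
    simp only [LinearMap.mk₂_apply, GHom.gsmul, GHom.mk_app, LinearMap.comp_apply]
    exact GMod.mul_smul _ _ _ _ _ _ _

/-- Composition of linear maps of degrees `d` and `e`. -/
def GHom.comp {G : ℤ → Type*} [∀ i, AddCommGroup (G i)] [∀ i, Module ℝ (G i)] [GMod A G]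
    {d e n : ℤ} (h : d + e = n) (χ : GHom A F G e) (φ : GHom A E F d) : GHom A E G n :=
  GHom.mk
    (fun p q hpq => (χ.app (by omega : p + d + e = q)).comp (φ.app rfl))
    (by
      intro p q r l m h₁ h₂ h₃ h₄ b x
      simp only [LinearMap.comp_apply]
      rw [φ.map_gsmul h₁ rfl rfl (by omega), map_smul,
        χ.map_gsmul (by omega) (by omega) (by omega) h₄, smul_smul,
        ← zpow_add₀ (by norm_num), ← mul_add, h])

/-- An isomorphism is a linear map all of whose components are bijective. -/
def GHom.IsIso {d : ℤ} (φ : GHom A E F d) : Prop :=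
  ∀ (i j : ℤ) (h : i + d = j), Function.Bijective (φ.app h)

/-- The inverse, of degree `-d`, of an isomorphism of degree `d`. -/
def GHom.inv {d : ℤ} (φ : GHom A E F d) (hφ : φ.IsIso) : GHom A F E (-d) :=
  GHom.mk
    (fun p q hpq => (LinearEquiv.ofBijective (φ.app (by omega : q + d = p)) (hφ _ _ _)).symm)
    (by
      intro p q r l m h₁ h₂ h₃ h₄ b x
      simp only [LinearEquiv.coe_coe]
      rw [LinearEquiv.symm_apply_eq, LinearEquiv.ofBijective_apply, map_smul,
        φ.map_gsmul h₄ (by omega) (by omega : m + d = q) h₁, smul_smul,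
        ← zpow_add₀ (by norm_num)]
      have hx : φ.app (by omega : m + d = q)
          ((LinearEquiv.ofBijective (φ.app (by omega : m + d = q)) (hφ _ _ _)).symm x) = x :=
        (LinearEquiv.ofBijective (φ.app (by omega : m + d = q)) (hφ _ _ _)).apply_symm_apply x
      rw [hx, mul_neg, neg_add_cancel, zpow_zero, _root_.one_smul])

variable (A E) in
/-- The dual module `E* = Hom_A(E, A)`: `α (a x) = (-1)^(|α| |a|) a α(x)`. -/
abbrev GDual : ℤ → Type (max w v) := GHom A E A

/-- The transpose `φᵀ : F* → E*` of a map of degree `d`, `φᵀ(α)(x) = (-1)^(|α| d) α(φ(x))`. -/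
def GHom.transpose {d : ℤ} (φ : GHom A E F d) : GHom A (GDual A F) (GDual A E) d :=
  GHom.mk
    (fun p q hpq =>
      { toFun := fun α => (-1 : ℝ) ^ (p * d) • GHom.comp (by omega : d + p = q) α φ
        map_add' := by
          intro α β
          apply GHom.ext
          intro i j hij x
          simp [GHom.smul_app, GHom.add_app, GHom.comp, GHom.mk_app]
        map_smul' := by
          intro c α
          apply GHom.ext
          intro i j hij x
          simp only [GHom.smul_app, GHom.comp, GHom.mk_app, LinearMap.comp_apply,
            RingHom.id_apply]
          rw [smul_comm] })
    (by
      intro p q r l m h₁ h₂ h₃ h₄ b α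
      apply GHom.ext
      intro i j hij x
      simp only [LinearMap.coe_mk, AddHom.coe_mk, GHom.smul_app]
      simp only [GMod.smul, LinearMap.mk₂_apply, GHom.gsmul, GHom.comp, GHom.mk_app,
        LinearMap.comp_apply, GHom.smul_app, map_smul]
      rw [smul_smul, ← zpow_add₀ (by norm_num), show p * d + q * d = r * d by rw [← h₁]; ring]
      congr 1
      exact smul_reindex A A (fun s hs => α.app hs (φ.app rfl x)) _ _ _ _ b)

end Hom

section Derivations

/-- Graded derivations of degree `d`: `X(fg) = X(f) g + (-1)^(d |f|) f X(g)`. -/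
def derSubmodule (d : ℤ) :
    Submodule ℝ (∀ p : {p : ℤ × ℤ // p.1 + d = p.2}, A p.1.1 →ₗ[ℝ] A p.1.2) where
  carrier := {X | ∀ (i j k l m n : ℤ) (h₁ : i + j = k) (h₂ : k + d = l) (h₃ : i + d = m)
    (h₄ : m + j = l) (h₅ : j + d = n) (h₆ : i + n = l) (f : A i) (g : A j),
    X ⟨(k, l), h₂⟩ (GCAlg.mul h₁ f g)
      = GCAlg.mul h₄ (X ⟨(i, m), h₃⟩ f) g
        + (-1 : ℝ) ^ (d * i) • GCAlg.mul h₆ f (X ⟨(j, n), h₅⟩ g)}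
  add_mem' := by
    intro X Y hX hY i j k l m n h₁ h₂ h₃ h₄ h₅ h₆ f g
    simp only [Pi.add_apply, LinearMap.add_apply, map_add, smul_add]
    rw [hX i j k l m n h₁ h₂ h₃ h₄ h₅ h₆, hY i j k l m n h₁ h₂ h₃ h₄ h₅ h₆]
    abel
  zero_mem' := by
    intro i j k l m n h₁ h₂ h₃ h₄ h₅ h₆ f g
    simp
  smul_mem' := by
    intro c X hX i j k l m n h₁ h₂ h₃ h₄ h₅ h₆ f g
    simp only [Pi.smul_apply, LinearMap.smul_apply, map_smul]
    rw [hX i j k l m n h₁ h₂ h₃ h₄ h₅ h₆, smul_add, smul_comm]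

/-- The space of graded derivations of `A` of degree `d`. -/
def GDer (d : ℤ) : Type v := ↥(derSubmodule A d)

instance (d : ℤ) : AddCommGroup (GDer A d) :=
  inferInstanceAs (AddCommGroup ↥(derSubmodule A d))

instance (d : ℤ) : Module ℝ (GDer A d) :=
  inferInstanceAs (Module ℝ ↥(derSubmodule A d))

variable {A}

/-- The component `A i → A j`, `j = i + d`, of a derivation of degree `d`. -/
def GDer.app {d : ℤ} (X : GDer A d) {i j : ℤ} (h : i + d = j) : A i →ₗ[ℝ] A j :=
  X.1 ⟨(i, j), h⟩

theorem GDer.leibniz {d : ℤ} (X : GDer A d) {i j k l m n : ℤ} (h₁ : i + j = k) (h₂ : k + d = l)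
    (h₃ : i + d = m) (h₄ : m + j = l) (h₅ : j + d = n) (h₆ : i + n = l) (f : A i) (g : A j) :
    X.app h₂ (GCAlg.mul h₁ f g)
      = GCAlg.mul h₄ (X.app h₃ f) g + (-1 : ℝ) ^ (d * i) • GCAlg.mul h₆ f (X.app h₅ g) :=
  X.2 i j k l m n h₁ h₂ h₃ h₄ h₅ h₆ f g

theorem GDer.ext {d : ℤ} {X Y : GDer A d}
    (H : ∀ (i j : ℤ) (h : i + d = j) (f : A i), X.app h f = Y.app h f) : X = Y := by
  apply Subtype.ext
  funext ⟨⟨i, j⟩, h⟩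
  exact LinearMap.ext (H i j h)

theorem GDer.add_app {d : ℤ} (X Y : GDer A d) {i j : ℤ} (h : i + d = j) (f : A i) :
    (X + Y).app h f = X.app h f + Y.app h f := rfl

theorem GDer.smul_app {d : ℤ} (c : ℝ) (X : GDer A d) {i j : ℤ} (h : i + d = j) (f : A i) :
    (c • X).app h f = c • X.app h f := rfl

/-- Constructor for graded derivations. -/
def GDer.mk {d : ℤ} (X : ∀ (i j : ℤ), i + d = j → A i →ₗ[ℝ] A j)
    (H : ∀ (i j k l m n : ℤ) (h₁ : i + j = k) (h₂ : k + d = l) (h₃ : i + d = m)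
      (h₄ : m + j = l) (h₅ : j + d = n) (h₆ : i + n = l) (f : A i) (g : A j),
      X k l h₂ (GCAlg.mul h₁ f g)
        = GCAlg.mul h₄ (X i m h₃ f) g + (-1 : ℝ) ^ (d * i) • GCAlg.mul h₆ f (X j n h₅ g)) :
    GDer A d :=
  ⟨fun p => X p.1.1 p.1.2 p.2, H⟩

theorem GDer.mk_app {d : ℤ} (X : ∀ (i j : ℤ), i + d = j → A i →ₗ[ℝ] A j) (H) {i j : ℤ}
    (h : i + d = j) (f : A i) : (GDer.mk X H).app h f = X i j h f := rfl

/-- Multiplication of a derivation by a function, `(f X)(g) = f X(g)`. -/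
def GDer.gsmul {i j k : ℤ} (h : i + j = k) (a : A i) (X : GDer A j) : GDer A k :=
  GDer.mk
    (fun p q hpq => (GCAlg.mul (by omega : i + (p + j) = q) a).comp (X.app rfl))
    (by
      intro p q r l m n h₁ h₂ h₃ h₄ h₅ h₆ f g
      simp only [LinearMap.comp_apply]
      rw [X.leibniz h₁ rfl rfl (by omega) rfl (by omega), map_add, map_smul]
      congr 1
      · rw [GCAlg.mul_assoc]
      · have := smul_left_comm A A (by omega : p + (q + j) = r + j) (by omega) 
          (by omega : i + (q + j) = n) h₆ f a (X.app rfl g)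
        refine (congrArg _ this).trans ?_
        rw [smul_smul, ← zpow_add₀ (by norm_num), ← add_mul, add_comm j i, h]
        rfl)

/-- The graded `A`-module of derivations. -/
instance : GMod A (GDer A) where
  smul {i j k} h := LinearMap.mk₂ ℝ (fun a X => GDer.gsmul h a X)
    (by
      intro a b X
      apply GDer.ext
      intro p q hpq x
      simp [GDer.gsmul, GDer.mk_app, GDer.add_app])
    (by
      intro c a X
      apply GDer.ext
      intro p q hpq x
      simp [GDer.gsmul, GDer.mk_app, GDer.smul_app])
    (by
      intro a X Y
      apply GDer.ext
      intro p q hpq x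
      simp [GDer.gsmul, GDer.mk_app, GDer.add_app])
    (by
      intro c a X
      apply GDer.ext
      intro p q hpq x
      simp [GDer.gsmul, GDer.mk_app, GDer.smul_app])
  one_smul {i} h X := by
    apply GDer.ext
    intro p q hpq x
    subst hpq
    simp [GDer.gsmul, GDer.mk_app, GCAlg.one_mul]
  mul_smul h₁ h₂ h₃ h₄ a b X := by
    apply GDer.ext
    intro p q hpq x
    simp only [LinearMap.mk₂_apply, GDer.gsmul, GDer.mk_app, LinearMap.comp_apply]
    exact GCAlg.mul_assoc _ _ _ _ _ _ _

/-- The graded commutator `[X, Y](f) = X(Y(f)) - (-1)^(|X| |Y|) Y(X(f))`. -/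
def GDer.commutator {d e n : ℤ} (h : d + e = n) (X : GDer A d) (Y : GDer A e) : GDer A n :=
  GDer.mk
    (fun p q hpq => (X.app (by omega : p + e + d = q)).comp (Y.app rfl)
      - (-1 : ℝ) ^ (d * e) • (Y.app (by omega : p + d + e = q)).comp (X.app rfl))
    (by
      intro p q r l m k h₁ h₂ h₃ h₄ h₅ h₆ f g
      simp only [LinearMap.sub_apply, LinearMap.smul_apply, LinearMap.comp_apply]
      rw [Y.leibniz h₁ rfl rfl (by omega) rfl (by omega),
        X.leibniz h₁ rfl rfl (by omega) rfl (by omega)]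
      simp only [map_add, map_smul, map_sub, LinearMap.sub_apply, LinearMap.smul_apply]
      rw [X.leibniz (by omega) (by omega) (by omega : p + e + d = m) h₄ rfl (by omega),
        X.leibniz (by omega) (by omega) rfl (by omega) (by omega : q + e + d = k) h₆,
        Y.leibniz (by omega) (by omega) (by omega : p + d + e = m) h₄ rfl (by omega),
        Y.leibniz (by omega) (by omega) rfl (by omega) (by omega : q + d + e = k) h₆]
      have hsq : ((-1 : ℝ) ^ (d * e)) * ((-1 : ℝ) ^ (d * e)) = 1 := by
        rw [← mul_zpow]; norm_num
      have e1 : (-1 : ℝ) ^ (d * (p + e)) = (-1 : ℝ) ^ (d * p) * (-1 : ℝ) ^ (d * e) := by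
        rw [mul_add, zpow_add₀ (by norm_num)]
      have e2 : (-1 : ℝ) ^ (e * (p + d)) = (-1 : ℝ) ^ (e * p) * (-1 : ℝ) ^ (d * e) := by
        rw [mul_add, zpow_add₀ (by norm_num), mul_comm e d]
      have e3 : (-1 : ℝ) ^ (n * p) = (-1 : ℝ) ^ (d * p) * (-1 : ℝ) ^ (e * p) := by
        rw [← h, add_mul, zpow_add₀ (by norm_num)]
      rw [e1, e2, e3]
      simp only [smul_add, smul_sub, smul_smul]
      have e4 : (-1 : ℝ) ^ (d * e) * ((-1 : ℝ) ^ (e * p) * (-1 : ℝ) ^ (d * e))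
          = (-1 : ℝ) ^ (e * p) := by
        rw [mul_comm, mul_assoc, hsq, mul_one]
      rw [e4, mul_comm ((-1 : ℝ) ^ (d * e)) ((-1 : ℝ) ^ (d * p)),
        mul_comm ((-1 : ℝ) ^ (e * p)) ((-1 : ℝ) ^ (d * p)),
        mul_left_comm ((-1 : ℝ) ^ (d * e)) ((-1 : ℝ) ^ (d * p)) ((-1 : ℝ) ^ (e * p)),
        mul_comm ((-1 : ℝ) ^ (d * e)) ((-1 : ℝ) ^ (e * p)), mul_assoc]
      abel)

variable (A)

/-- One-forms: the dual module of the module of derivations. -/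
abbrev OneForm : ℤ → Type v := GDual A (GDer A)

variable {A}

/-- The exterior differential of functions, `(df)(X) = (-1)^((|X| - 1) |f|) X(f)`. -/
def extD {i : ℤ} : A i →ₗ[ℝ] OneForm A i where
  toFun f := GHom.mk
    (fun p q hpq =>
      { toFun := fun X => (-1 : ℝ) ^ ((p - 1) * i) • X.app (by omega : i + p = q) f
        map_add' := by
          intro X Y
          rw [GDer.add_app, smul_add]
        map_smul' := by
          intro c X
          rw [GDer.smul_app, smul_comm]
          rfl })
    (by
      intro p q r l m h₁ h₂ h₃ h₄ a X
      simp only [LinearMap.coe_mk, AddHom.coe_mk]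
      subst h₁ h₂ h₃
      rw [map_smul, smul_smul, ← zpow_add₀ (by norm_num)]
      have : (p + q - 1) * i = p * i + (q - 1) * i := by ring
      rw [this]
      congr 1
      simp only [GMod.smul, LinearMap.mk₂_apply, GDer.gsmul, GDer.mk_app, LinearMap.comp_apply]
      exact smul_reindex A A (fun s hs => X.app hs f) _ _ _ _ a)
  map_add' := by
    intro f g
    apply GHom.ext
    intro p q hpq X
    simp [GHom.mk_app, GHom.add_app]
  map_smul' := by
    intro c f
    apply GHom.ext
    intro p q hpq X
    simp only [GHom.mk_app, GHom.smul_app, LinearMap.coe_mk, AddHom.coe_mk, map_smul,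
      RingHom.id_apply]
    rw [smul_comm]

end Derivations

section Shift

variable {A}

/-- The degree shift `E[ℓ]`, `E[ℓ]_j = E_(j + ℓ)`. -/
def Shift (E : ℤ → Type w) (ℓ : ℤ) : ℤ → Type w := fun j => E (j + ℓ)

variable {E : ℤ → Type w} [∀ i, AddCommGroup (E i)] [∀ i, Module ℝ (E i)] [GMod A E]

instance (ℓ j : ℤ) : AddCommGroup (Shift E ℓ j) := inferInstanceAs (AddCommGroup (E (j + ℓ)))

instance (ℓ j : ℤ) : Module ℝ (Shift E ℓ j) := inferInstanceAs (Module ℝ (E (j + ℓ)))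

/-- The shifted action `f ▷' x = (-1)^(|f| ℓ) f x`. -/
instance (ℓ : ℤ) : GMod A (Shift E ℓ) where
  smul {i j k} h :=
    (((-1 : ℝ) ^ (i * ℓ) • GMod.smul (by omega : i + (j + ℓ) = k + ℓ) :
      A i →ₗ[ℝ] E (j + ℓ) →ₗ[ℝ] E (k + ℓ)) :)
  one_smul {i} h x := by
    change (-1 : ℝ) ^ (0 * ℓ) • (GMod.smul _ GCAlg.one (x : E (i + ℓ)) : E (i + ℓ)) = x
    rw [zero_mul, zpow_zero, _root_.one_smul]
    exact GMod.one_smul (E := E) _ _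
  mul_smul {i j k m n l} h₁ h₂ h₃ h₄ a b x := by
    change (-1 : ℝ) ^ (m * ℓ) • (GMod.smul _ (GCAlg.mul h₁ a b) (x : E (k + ℓ)) : E (l + ℓ))
      = (-1 : ℝ) ^ (i * ℓ) • (GMod.smul (by omega : i + (n + ℓ) = l + ℓ) a
        ((-1 : ℝ) ^ (j * ℓ) • (GMod.smul (by omega : j + (k + ℓ) = n + ℓ) b
          (x : E (k + ℓ)) : E (n + ℓ))) : E (l + ℓ))
    rw [map_smul, smul_smul, ← zpow_add₀ (by norm_num), ← add_mul, h₁]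
    congr 1
    exact GMod.mul_smul (E := E) (by omega) (by omega) (by omega) (by omega) a b x

/-- A linear map `E → F` of degree `ℓ`, regarded as a linear map `E → F[ℓ]` of degree zero. -/
def GHom.toShift {F : ℤ → Type u} [∀ i, AddCommGroup (F i)] [∀ i, Module ℝ (F i)] [GMod A F]
    {ℓ : ℤ} (φ : GHom A E F ℓ) : GHom A E (Shift F ℓ) 0 :=
  GHom.mk
    (fun i j h => (φ.app (by omega : i + ℓ = j + ℓ) : E i →ₗ[ℝ] F (j + ℓ)))
    (by
      intro p q r l m h₁ h₂ h₃ h₄ b x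
      rw [mul_zero, zpow_zero, _root_.one_smul]
      exact φ.map_gsmul h₁ (by omega) (by omega) (by omega) b x)

end Shift

end Algebra

/-! ## Graded domains -/

/-- A graded dimension: the number `dim₀` of coordinates of degree `0` and the nonzero degrees
`deg μ` of the remaining coordinates `ξ_μ`. -/
structure GradedDim where
  dim₀ : ℕ
  num : ℕ
  deg : Fin num → ℤ
  deg_ne_zero : ∀ μ, deg μ ≠ 0

/-- The sequence `(n_j)` of a graded dimension. -/
def GradedDim.seq (n : GradedDim) (j : ℤ) : ℕ :=
  if j = 0 then n.dim₀ else Fintype.card {μ : Fin n.num // n.deg μ = j}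

/-- The space `ℝ^(n₀)`. -/
abbrev GradedDim.Space (n : GradedDim) : Type := EuclideanSpace ℝ (Fin n.dim₀)

/-- `p` is the exponent of a monomial `ξ^p` of degree `k`. -/
def GradedDim.IsExponent (n : GradedDim) (k : ℤ) (p : Fin n.num → ℕ) : Prop :=
  (∀ μ, Odd (n.deg μ) → p μ ≤ 1) ∧ ∑ μ, (p μ : ℤ) * n.deg μ = k

/-- The sign `ε` with `ξ^q ξ^r = ε ξ^(q + r)`: every `ξ_μ` in `ξ^r` has to pass every `ξ_ν` in
`ξ^q` with `μ < ν`. -/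
def GradedDim.sign (n : GradedDim) (q r : Fin n.num → ℕ) : ℝ :=
  (-1 : ℝ) ^ (∑ ν, ∑ μ ∈ Finset.univ.filter (· < ν),
    (q ν : ℤ) * (r μ : ℤ) * (n.deg ν * n.deg μ))

/-- Smooth functions on an open subset of `ℝ^(n₀)`. -/
abbrev GradedDim.Smooth (n : GradedDim) (V : Opens n.Space) : Type :=
  C^∞⟮𝓡 n.dim₀, V; 𝓘(ℝ, ℝ), ℝ⟯

/-- Functions of degree `k` on a graded domain: formal power series `∑ f_p ξ^p` over the
exponents of degree `k`, with smooth coefficients, encoded by the family `p ↦ f_p`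
(zero for all other `p`). -/
def GradedDim.Fn (n : GradedDim) (V : Opens n.Space) (k : ℤ) :
    Submodule ℝ ((Fin n.num → ℕ) → n.Smooth V) where
  carrier := {f | ∀ p, ¬ n.IsExponent k p → f p = 0}
  add_mem' := by
    intro f g hf hg p hp
    rw [Pi.add_apply, hf p hp, hg p hp, add_zero]
  zero_mem' := by
    intro _ _
    rfl
  smul_mem' := by
    intro c f hf p hp
    rw [Pi.smul_apply, hf p hp, smul_zero]

open Classical in
/-- The product `(f g)_p = ∑_(q ≤ p) ε(q, p - q) f_q g_(p - q)`. -/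
def GradedDim.mul (n : GradedDim) {V : Opens n.Space} {i j k : ℤ} (_h : i + j = k)
    (f : n.Fn V i) (g : n.Fn V j) : n.Fn V k :=
  ⟨fun p => if n.IsExponent k p then
      ∑ q ∈ Finset.Iic p, n.sign q (p - q) • (f.1 q * g.1 (p - q)) else 0,
    fun _ hp => if_neg hp⟩

/-- The unit: the power series with constant term `1`. -/
def GradedDim.one (n : GradedDim) (V : Opens n.Space) : n.Fn V 0 :=
  ⟨fun p => if p = 0 then 1 else 0, by
    intro p hp
    refine if_neg ?_
    rintro rfl
    exact hp ⟨by simp, by simp⟩⟩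

/-- Restriction to a smaller open subset, coefficient by coefficient. -/
def GradedDim.res (n : GradedDim) {V W : Opens n.Space} (h : W ≤ V) {k : ℤ} (f : n.Fn V k) :
    n.Fn W k :=
  ⟨fun p => ContMDiffMap.restrictRingHom (𝓡 n.dim₀) 𝓘(ℝ, ℝ) ℝ h (f.1 p), by
    intro p hp
    exact (congrArg _ (f.2 p hp)).trans (map_zero _)⟩

/-! ## Graded manifolds -/

/-- Sheaves of graded commutative algebras on a topological space. -/
structure GCAlgSheaf (M : Type u) [TopologicalSpace M] where
  Fn : Opens M → ℤ → Type v
  [addCommGroup : ∀ U i, AddCommGroup (Fn U i)]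
  [module : ∀ U i, Module ℝ (Fn U i)]
  [alg : ∀ U, GCAlg (Fn U)]
  res : ∀ {U V : Opens M}, V ≤ U → ∀ {i : ℤ}, Fn U i →ₗ[ℝ] Fn V i
  res_self : ∀ {U : Opens M} {i : ℤ} (f : Fn U i), res le_rfl f = f
  res_res : ∀ {U V W : Opens M} (h : V ≤ U) (h' : W ≤ V) {i : ℤ} (f : Fn U i),
    res h' (res h f) = res (h'.trans h) f
  res_one : ∀ {U V : Opens M} (h : V ≤ U), res h (GCAlg.one : Fn U 0) = GCAlg.one
  res_mul : ∀ {U V : Opens M} (h : V ≤ U) {i j k : ℤ} (hk : i + j = k) (f : Fn U i) (g : Fn U j),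
    res h (GCAlg.mul hk f g) = GCAlg.mul hk (res h f) (res h g)
  glue : ∀ {ι : Type u} (U : ι → Opens M) (i : ℤ) (s : ∀ a, Fn (U a) i),
    (∀ a b, res (inf_le_left : U a ⊓ U b ≤ U a) (s a) = res inf_le_right (s b)) →
    ∃! t : Fn (⨆ a, U a) i, ∀ a, res (le_iSup U a) t = s a

attribute [instance] GCAlgSheaf.addCommGroup GCAlgSheaf.module GCAlgSheaf.alg

section Manifold

variable {M : Type u} [TopologicalSpace M]

/-- The germ of `f` at `m` is invertible in the stalk at `m`. -/
def GCAlgSheaf.IsUnitAt (S : GCAlgSheaf.{u, v} M) (m : M) {U : Opens M} {i : ℤ} (f : S.Fn U i) :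
    Prop :=
  ∃ (V : Opens M) (h : V ≤ U) (g : S.Fn V (-i)), m ∈ V ∧
    GCAlg.mul (add_neg_cancel i) (S.res h f) g = GCAlg.one

/-- Each stalk is a local graded ring: its homogeneous non-units form a proper graded ideal
(they are always stable under multiplication). -/
def GCAlgSheaf.IsLocallyRinged (S : GCAlgSheaf.{u, v} M) : Prop :=
  ∀ (m : M) (U : Opens M), m ∈ U →
    ¬ S.IsUnitAt m (0 : S.Fn U 0) ∧
    ∀ (i : ℤ) (f g : S.Fn U i), S.IsUnitAt m (f + g) → S.IsUnitAt m f ∨ S.IsUnitAt m g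

/-- The preimage of an open subset under a partial homeomorphism. -/
def preimageOpens {X : Type*} [TopologicalSpace X] (φ : OpenPartialHomeomorph M X)
    (V : Opens X) : Opens M :=
  ⟨φ.source ∩ φ ⁻¹' V, φ.isOpen_inter_preimage V.2⟩

theorem preimageOpens_mono {X : Type*} [TopologicalSpace X] (φ : OpenPartialHomeomorph M X)
    {V W : Opens X} (h : W ≤ V) : preimageOpens φ W ≤ preimageOpens φ V :=
  fun _ hx => ⟨hx.1, h hx.2⟩

/-- A graded chart: a homeomorphism `φ` of an open subset of `M` onto an open subset of `ℝ^(n₀)`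
with isomorphisms `C^∞(V) ≅ C^∞_M(φ⁻¹(V))` of graded algebras, natural in `V`, from
the functions on the graded domain to those on the manifold. -/
structure GradedChart (S : GCAlgSheaf.{u, v} M) (n : GradedDim) where
  φ : OpenPartialHomeomorph M n.Space
  pullback : ∀ (V : Opens n.Space), (V : Set n.Space) ⊆ φ.target → ∀ (i : ℤ),
    n.Fn V i ≃ₗ[ℝ] S.Fn (preimageOpens φ V) i
  pullback_one : ∀ (V : Opens n.Space) (hV : (V : Set n.Space) ⊆ φ.target),
    pullback V hV 0 (n.one V) = GCAlg.one
  pullback_mul : ∀ (V : Opens n.Space) (hV : (V : Set n.Space) ⊆ φ.target) {i j k : ℤ}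
    (h : i + j = k) (f : n.Fn V i) (g : n.Fn V j),
    pullback V hV k (n.mul h f g) = GCAlg.mul h (pullback V hV i f) (pullback V hV j g)
  pullback_res : ∀ (V W : Opens n.Space) (hV : (V : Set n.Space) ⊆ φ.target)
    (hW : (W : Set n.Space) ⊆ φ.target) (h : W ≤ V) (i : ℤ) (f : n.Fn V i),
    pullback W hW i (n.res h f) = S.res (preimageOpens_mono φ h) (pullback V hV i f)

end Manifold

/-- Graded manifolds with underlying topological space `M`. -/
structure GradedManifold (M : Type u) [TopologicalSpace M] extends GCAlgSheaf.{u, v} M where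
  t2 : T2Space M
  secondCountable : SecondCountableTopology M
  isLocallyRinged : toGCAlgSheaf.IsLocallyRinged
  gdim : GradedDim
  exists_chart : ∀ m : M, ∃ c : GradedChart toGCAlgSheaf gdim, m ∈ c.φ.source

section Bundles

variable {M : Type u} [TopologicalSpace M]

/-- Graded vector bundles: sheaves of graded modules which are locally freely and finitely
generated.  The graded rank is given by the degrees `frameDeg a` of the elements of local
frames. -/
structure GradedVectorBundle (X : GradedManifold.{u, v} M) where
  Sec : Opens M → ℤ → Type w
  [addCommGroup : ∀ U i, AddCommGroup (Sec U i)]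
  [module : ∀ U i, Module ℝ (Sec U i)]
  [gmod : ∀ U, GMod (X.Fn U) (Sec U)]
  res : ∀ {U V : Opens M}, V ≤ U → ∀ {i : ℤ}, Sec U i →ₗ[ℝ] Sec V i
  res_self : ∀ {U : Opens M} {i : ℤ} (s : Sec U i), res le_rfl s = s
  res_res : ∀ {U V W : Opens M} (h : V ≤ U) (h' : W ≤ V) {i : ℤ} (s : Sec U i),
    res h' (res h s) = res (h'.trans h) s
  res_smul : ∀ {U V : Opens M} (h : V ≤ U) {i j k : ℤ} (hk : i + j = k) (f : X.Fn U i)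
    (s : Sec U j), res h (GMod.smul hk f s : Sec U k) = GMod.smul hk (X.res h f) (res h s)
  glue : ∀ {ι : Type u} (U : ι → Opens M) (i : ℤ) (s : ∀ a, Sec (U a) i),
    (∀ a b, res (inf_le_left : U a ⊓ U b ≤ U a) (s a) = res inf_le_right (s b)) →
    ∃! t : Sec (⨆ a, U a) i, ∀ a, res (le_iSup U a) t = s a
  rank : ℕ
  frameDeg : Fin rank → ℤ
  exists_frame : ∀ m : M, ∃ (U : Opens M) (Φ : ∀ a, Sec U (frameDeg a)), m ∈ U ∧
    ∀ (V : Opens M) (h : V ≤ U) (k : ℤ) (s : Sec V k),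
      ∃! f : ∀ a, X.Fn V (k - frameDeg a),
        s = ∑ a, (GMod.smul (sub_add_cancel k (frameDeg a)) (f a) (res h (Φ a)) : Sec V k)

attribute [instance] GradedVectorBundle.addCommGroup GradedVectorBundle.module
  GradedVectorBundle.gmod

/-- Global functions. -/
abbrev GradedManifold.Fun (X : GradedManifold.{u, v} M) : ℤ → Type v := X.Fn ⊤

/-- Global vector fields: the graded derivations of the algebra of global functions. -/
abbrev GradedManifold.VecField (X : GradedManifold.{u, v} M) : ℤ → Type v := GDer X.Fun

/-- Global sections. -/
abbrev GradedVectorBundle.Γ {X : GradedManifold.{u, v} M} (E : GradedVectorBundle.{u, v, w} X) :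
    ℤ → Type w := E.Sec ⊤

/-- Vector bundle maps `E → T M` of degree `d`, that is, `C^∞(M)`-linear maps of degree `d`
between the modules of global sections. -/
abbrev AnchorMap {X : GradedManifold.{u, v} M} (E : GradedVectorBundle.{u, v, w} X) (d : ℤ) :
    Type (max w v) := GHom X.Fun E.Γ X.VecField d

/-- Vector bundle maps `E → E*` of degree `d`. -/
abbrev MetricMap {X : GradedManifold.{u, v} M} (E : GradedVectorBundle.{u, v, w} X) (d : ℤ) :
    Type (max w v) := GHom X.Fun E.Γ (GDual X.Fun E.Γ) d

/-! ## Graded Courant algebroids -/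

variable {X : GradedManifold.{u, v} M} {E : GradedVectorBundle.{u, v, w} X} {ℓ : ℤ}

/-- The pairing `⟨ψ, ψ'⟩ = (-1)^((|ψ| + ℓ) ℓ) g(ψ)(ψ')`. -/
def pairing (g : MetricMap E ℓ) {i j k : ℤ} (h : i + j + ℓ = k) (ψ : E.Γ i) (ψ' : E.Γ j) :
    X.Fun k :=
  (-1 : ℝ) ^ ((i + ℓ) * ℓ) • (g.app rfl ψ).app (by omega : j + (i + ℓ) = k) ψ'

/-- A fiber-wise metric of degree `ℓ`: a vector bundle isomorphism `g : E → E*` of degree `ℓ`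
whose pairing is graded symmetric. -/
structure IsMetric (g : MetricMap E ℓ) : Prop where
  symm : ∀ {i j k : ℤ} (h : i + j + ℓ = k) (h' : j + i + ℓ = k) (ψ : E.Γ i) (ψ' : E.Γ j),
    pairing g h ψ ψ' = (-1 : ℝ) ^ ((i + ℓ) * (j + ℓ)) • pairing g h' ψ' ψ
  isIso : g.IsIso

/-- The vector field `ρ̂(ψ) = (-1)^((|ψ| + ℓ) ℓ) ρ(ψ)`. -/
def hatAnchor (ρ : AnchorMap E ℓ) {i : ℤ} (ψ : E.Γ i) : X.VecField (i + ℓ) :=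
  (-1 : ℝ) ^ ((i + ℓ) * ℓ) • ρ.app rfl ψ

/-- The map `ρ* = g⁻¹ ∘ ρᵀ : T* M → E` of degree zero. -/
def coanchor (ρ : AnchorMap E ℓ) (g : MetricMap E ℓ) (hg : IsMetric g) :
    GHom X.Fun (OneForm X.Fun) E.Γ 0 :=
  GHom.comp (add_neg_cancel ℓ) (g.inv hg.isIso) ρ.transpose

/-- The map `D = g⁻¹ ∘ ρᵀ ∘ d` from functions to sections. -/
def courantD (ρ : AnchorMap E ℓ) (g : MetricMap E ℓ) (hg : IsMetric g) {i : ℤ} :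
    X.Fun i →ₗ[ℝ] E.Γ i :=
  ((coanchor ρ g hg).app (add_zero i)).comp extD

/-- Graded Courant algebroid structures of degree `ℓ` on the graded vector bundle `E`. -/
structure GradedCourantAlgebroid (E : GradedVectorBundle.{u, v, w} X) (ℓ : ℤ) where
  /-- the anchor -/
  ρ : AnchorMap E ℓ
  g : MetricMap E ℓ
  isMetric : IsMetric g
  bracket : ∀ {i j k : ℤ}, i + j + ℓ = k → E.Γ i →ₗ[ℝ] E.Γ j →ₗ[ℝ] E.Γ k
  pairing_comp : ∀ {i j k p q r : ℤ} (hjk : j + k + ℓ = p) (hr : p + (i + ℓ) = r)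
    (hij : i + j + ℓ = q) (hq : q + k + ℓ = r) {s : ℤ} (hik : i + k + ℓ = s) (hs : j + s + ℓ = r)
    (ψ : E.Γ i) (ψ' : E.Γ j) (ψ'' : E.Γ k),
    (hatAnchor ρ ψ).app hr (pairing g hjk ψ' ψ'')
      = pairing g hq (bracket hij ψ ψ') ψ''
        + (-1 : ℝ) ^ ((i + ℓ) * (j + ℓ)) • pairing g hs ψ' (bracket hik ψ ψ'')
  skew_symm : ∀ {i j k : ℤ} (h : i + j + ℓ = k) (h' : j + i + ℓ = k) (ψ : E.Γ i) (ψ' : E.Γ j),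
    bracket h ψ ψ' + (-1 : ℝ) ^ ((i + ℓ) * (j + ℓ)) • bracket h' ψ' ψ
      = (-1 : ℝ) ^ (i + j) • courantD ρ g isMetric (pairing g h ψ ψ')
  jacobi : ∀ {i j k p q r s : ℤ} (hjk : j + k + ℓ = p) (hp : i + p + ℓ = s)
    (hij : i + j + ℓ = q) (hq : q + k + ℓ = s) (hik : i + k + ℓ = r) (hr : j + r + ℓ = s)
    (ψ : E.Γ i) (ψ' : E.Γ j) (ψ'' : E.Γ k),
    bracket hp ψ (bracket hjk ψ' ψ'')
      = bracket hq (bracket hij ψ ψ') ψ''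
        + (-1 : ℝ) ^ ((i + ℓ) * (j + ℓ)) • bracket hr ψ' (bracket hik ψ ψ'')

namespace GradedCourantAlgebroid

variable (C : GradedCourantAlgebroid E ℓ)

/-- The pairing of a graded Courant algebroid. -/
abbrev pair {i j k : ℤ} (h : i + j + ℓ = k) (ψ : E.Γ i) (ψ' : E.Γ j) : X.Fun k :=
  pairing C.g h ψ ψ'

/-- `ρ̂`. -/
abbrev ρhat {i : ℤ} (ψ : E.Γ i) : X.VecField (i + ℓ) := hatAnchor C.ρ ψ

/-- `ρ*`, a vector bundle map `T* M → E` of degree zero. -/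
abbrev ρstar : GHom X.Fun (OneForm X.Fun) E.Γ 0 := coanchor C.ρ C.g C.isMetric

/-- The anchor as a vector bundle map `E → T[ℓ] M` of degree zero. -/
abbrev ρshift : GHom X.Fun E.Γ (Shift X.VecField ℓ) 0 := C.ρ.toShift

/-- The map `D` from functions to sections. -/
abbrev D {i : ℤ} : X.Fun i →ₗ[ℝ] E.Γ i := courantD C.ρ C.g C.isMetric

end GradedCourantAlgebroid

end Bundles

end GradedGeometry

end

open GradedGeometry

noncomputable section

namespace GradedGeometry

/-! Two principles carry the proof: the pairing is nondegenerate, so a section is determined by its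
pairings, and a function is determined by its action on global sections unless all of these vanish.

The Leibniz rule (`bracket_gsmul`) follows from invariance of the pairing alone: expand
ρ̂(ψ)(f⟨ψ',ψ''⟩) as a derivation, compare with invariance for (ψ, fψ', ψ''), and cancel ψ''.
Inserting fψ'' into the Jacobi identity and expanding with this rule leaves (ρ̂([ψ,ψ'])f −
[ρ̂(ψ),ρ̂(ψ')]f)ψ'' = 0 for every ψ'', whence `hatAnchor_bracket_app`.

Applying ρ̂ to the symmetric part of the bracket kills it, because commutators are graded skew; so
ρ̂(D⟨ψ,ψ'⟩) = 0. Replacing ψ by fψ and using that D is a derivation gives ⟨ψ,ψ'⟩ρ̂(Df) = 0, hence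
ρ(Df) = 0 (`hatAnchor_courantD`). The remaining claims rest on ⟨ψ,Df⟩ = ±ρ̂(ψ)f
(`pairing_courantD_right`), again with nondegeneracy.

The one geometric input is the second principle, `eq_zero_or_of_gsmul_eq_zero`. Frames are only
local while the structure lives on global sections, so frame elements are first made global by bump
functions. -/

theorem sign_congr {m n : ℤ} (h : Even m ↔ Even n) : (-1 : ℝ) ^ m = (-1 : ℝ) ^ n := by
  by_cases hm : Even m
  · rw [hm.neg_one_zpow, (h.1 hm).neg_one_zpow]
  · rw [(Int.not_even_iff_odd.1 hm).neg_one_zpow,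
      (Int.not_even_iff_odd.1 (mt h.2 hm)).neg_one_zpow]

theorem sign_mul (m n : ℤ) : (-1 : ℝ) ^ m * (-1 : ℝ) ^ n = (-1 : ℝ) ^ (m + n) :=
  (zpow_add₀ (by norm_num) m n).symm

theorem sign_smul_eq_zero {V : Type*} [AddCommGroup V] [Module ℝ V] {n : ℤ} {x : V} :
    (-1 : ℝ) ^ n • x = 0 ↔ x = 0 :=
  smul_eq_zero_iff_right (zpow_ne_zero n (by norm_num))

theorem sign_smul_sign_smul {V : Type*} [AddCommGroup V] [Module ℝ V] (n : ℤ) (x : V) :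
    (-1 : ℝ) ^ n • (-1 : ℝ) ^ n • x = x := by
  rw [smul_smul, sign_mul, Even.neg_one_zpow ⟨n, rfl⟩, one_smul]

/-! ### Components of graded maps with free intermediate degrees -/

section Algebra

variable {A : ℤ → Type v} [∀ i, AddCommGroup (A i)] [∀ i, Module ℝ (A i)] [GCAlg A]
variable {E : ℤ → Type w} [∀ i, AddCommGroup (E i)] [∀ i, Module ℝ (E i)] [GMod A E]
variable {F : ℤ → Type u} [∀ i, AddCommGroup (F i)] [∀ i, Module ℝ (F i)] [GMod A F]

/-- The action is defined through the literal degree `p + j`. Allowing any `r` with a proof of the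
degree equation lets later rewrites pick whichever form of the degree is at hand, without casts; the
same holds for the evaluation lemmas below. -/
theorem GHom.gsmul_app {i j k p q r : ℤ} (h : i + j = k) (a : A i) (φ : GHom A E F j)
    (hp : p + k = q) (hr : p + j = r) (hq : i + r = q) (x : E p) :
    (GMod.smul h a φ : GHom A E F k).app hp x = GMod.smul hq a (φ.app hr x) := by
  subst hr
  rfl

theorem GDer.gsmul_app {i j k p q r : ℤ} (h : i + j = k) (a : A i) (X : GDer A j)
    (hp : p + k = q) (hr : p + j = r) (hq : i + r = q) (f : A p) :
    (GMod.smul h a X : GDer A k).app hp f = GCAlg.mul hq a (X.app hr f) := by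
  subst hr
  rfl

theorem GHom.comp_app {G : ℤ → Type*} [∀ i, AddCommGroup (G i)] [∀ i, Module ℝ (G i)] [GMod A G]
    {d e n i j k : ℤ} (h : d + e = n) (χ : GHom A F G e) (φ : GHom A E F d)
    (hn : i + n = k) (hd : i + d = j) (he : j + e = k) (x : E i) :
    (GHom.comp h χ φ).app hn x = χ.app he (φ.app hd x) := by
  subst hd
  rfl

theorem GHom.app_inv_app {d : ℤ} (φ : GHom A E F d) (hφ : φ.IsIso) {i j : ℤ} (h : i + d = j)
    (h' : j + -d = i) (y : F j) : φ.app h ((φ.inv hφ).app h' y) = y :=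
  (LinearEquiv.ofBijective (φ.app h) (hφ _ _ _)).apply_symm_apply y

theorem GHom.transpose_app_app {d : ℤ} (φ : GHom A E F d) {i j p q r : ℤ} (h : i + d = j)
    (hp : p + j = q) (hr : p + d = r) (hq : r + i = q) (α : GDual A F i) (x : E p) :
    (φ.transpose.app h α).app hp x = (-1 : ℝ) ^ (i * d) • α.app hq (φ.app hr x) := by
  subst hr
  rfl

theorem extD_app {i p q : ℤ} (f : A i) (h : p + i = q) (h' : i + p = q) (X : GDer A p) :
    (extD f).app h X = (-1 : ℝ) ^ ((p - 1) * i) • X.app h' f := rfl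

theorem GDer.commutator_app {d e n i j k l : ℤ} (h : d + e = n) (X : GDer A d) (Y : GDer A e)
    (hn : i + n = l) (hj : i + e = j) (hl : j + d = l) (hk : i + d = k) (hl' : k + e = l)
    (f : A i) :
    (GDer.commutator h X Y).app hn f
      = X.app hl (Y.app hj f) - (-1 : ℝ) ^ (d * e) • Y.app hl' (X.app hk f) := by
  subst hj hk
  rfl

end Algebra

/-! ### The pairing, its nondegeneracy, and D as a derivation -/

section Bundles

variable {M : Type u} [TopologicalSpace M]
variable {X : GradedManifold.{u, v} M} {E : GradedVectorBundle.{u, v, w} X} {ℓ : ℤ}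

/-- The pairing as a bilinear map. -/
def pairingₗ (g : MetricMap E ℓ) {i j k : ℤ} (h : i + j + ℓ = k) :
    E.Γ i →ₗ[ℝ] E.Γ j →ₗ[ℝ] X.Fun k :=
  LinearMap.mk₂ ℝ (pairing g h)
    (by intro a b c; simp [pairing, GHom.add_app])
    (by intro r a b; simp only [pairing, map_smul, GHom.smul_app]; rw [smul_comm])
    (by intro a b c; simp [pairing])
    (by intro r a b; simp only [pairing, map_smul]; rw [smul_comm])

theorem pairingₗ_apply (g : MetricMap E ℓ) {i j k : ℤ} (h : i + j + ℓ = k) (ψ : E.Γ i)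
    (ψ' : E.Γ j) : pairingₗ g h ψ ψ' = pairing g h ψ ψ' := rfl

/-- The prefactor in the pairing exactly absorbs the sign from the degree ℓ of g, which leaves plain
linearity in the first slot. -/
theorem pairing_gsmul_left (g : MetricMap E ℓ) {p i j k m n : ℤ} (hi : p + i = m)
    (hk : m + j + ℓ = k) (hn : i + j + ℓ = n) (hpn : p + n = k) (f : X.Fun p) (ψ : E.Γ i)
    (ψ' : E.Γ j) :
    pairing g hk (GMod.smul hi f ψ) ψ' = (GMod.smul hpn f (pairing g hn ψ ψ') : X.Fun k) := by
  unfold pairing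
  rw [g.map_gsmul hi rfl rfl (by omega), GHom.smul_app,
    GHom.gsmul_app _ _ _ _ (by omega : j + (i + ℓ) = n) hpn, map_smul, smul_smul, sign_mul]
  congr 1
  apply sign_congr
  subst hi
  simp only [Int.even_add, Int.even_mul]
  tauto

/-- This is injectivity of g; the version for the other slot follows by graded symmetry. -/
theorem eq_zero_of_pairing_right (g : MetricMap E ℓ) (hg : IsMetric g) {i : ℤ} (ψ : E.Γ i)
    (H : ∀ (j k : ℤ) (h : i + j + ℓ = k) (ψ' : E.Γ j), pairing g h ψ ψ' = 0) : ψ = 0 := by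
  apply (hg.isIso i _ rfl).1
  rw [map_zero]
  apply GHom.ext
  intro j k h ψ'
  exact sign_smul_eq_zero.1 (H j k (by omega) ψ')

theorem eq_zero_of_pairing_left (g : MetricMap E ℓ) (hg : IsMetric g) {i : ℤ} (ψ : E.Γ i)
    (H : ∀ (j k : ℤ) (h : j + i + ℓ = k) (ψ' : E.Γ j), pairing g h ψ' ψ = 0) : ψ = 0 := by
  apply eq_zero_of_pairing_right g hg
  intro j k h ψ'
  rw [hg.symm h (by omega), H, smul_zero]

theorem eq_of_pairing_right (g : MetricMap E ℓ) (hg : IsMetric g) {i : ℤ} (ψ φ : E.Γ i)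
    (H : ∀ (j k : ℤ) (h : i + j + ℓ = k) (ψ' : E.Γ j), pairing g h ψ ψ' = pairing g h φ ψ') :
    ψ = φ := by
  rw [← sub_eq_zero]
  apply eq_zero_of_pairing_right g hg
  intro j k h ψ'
  rw [← pairingₗ_apply, map_sub, LinearMap.sub_apply, pairingₗ_apply, pairingₗ_apply, H, sub_self]

theorem eq_of_pairing_left (g : MetricMap E ℓ) (hg : IsMetric g) {i : ℤ} (ψ φ : E.Γ i)
    (H : ∀ (j k : ℤ) (h : j + i + ℓ = k) (ψ' : E.Γ j), pairing g h ψ' ψ = pairing g h ψ' φ) :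
    ψ = φ := by
  rw [← sub_eq_zero]
  apply eq_zero_of_pairing_left g hg
  intro j k h ψ'
  rw [← pairingₗ_apply, map_sub, pairingₗ_apply, pairingₗ_apply, H, sub_self]

theorem metric_app_coanchor (ρ : AnchorMap E ℓ) (g : MetricMap E ℓ) (hg : IsMetric g) {i j k : ℤ}
    (h : i + 0 = j) (h' : j + ℓ = k) (h'' : i + ℓ = k) (α : OneForm X.Fun i) :
    g.app h' ((coanchor ρ g hg).app h α) = ρ.transpose.app h'' α := by
  unfold coanchor
  rw [GHom.comp_app _ _ _ _ h'' (by omega), GHom.app_inv_app]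

theorem pairing_coanchor_left (ρ : AnchorMap E ℓ) (g : MetricMap E ℓ) (hg : IsMetric g)
    {i i' j k m : ℤ} (h : i + 0 = i') (hk : i' + j + ℓ = k) (hj : j + ℓ = m) (hm : m + i = k)
    (α : OneForm X.Fun i) (ψ : E.Γ j) :
    pairing g hk ((coanchor ρ g hg).app h α) ψ = (-1 : ℝ) ^ ℓ • α.app hm (ρ.app hj ψ) := by
  unfold pairing
  rw [metric_app_coanchor ρ g hg h rfl (by omega), GHom.transpose_app_app _ _ _ hj hm,
    smul_smul, sign_mul]
  congr 1
  apply sign_congr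
  obtain rfl : i = i' := by omega
  simp only [Int.even_add, Int.even_mul]
  tauto

/-- The defining property of D: after symmetry moves Df to the left, g cancels against its inverse
in ρ*, and the transpose of ρ evaluates df on ρ(ψ). -/
theorem pairing_courantD_right (ρ : AnchorMap E ℓ) (g : MetricMap E ℓ) (hg : IsMetric g)
    {i p k : ℤ} (hk : i + p + ℓ = k) (hk' : p + (i + ℓ) = k) (ψ : E.Γ i) (f : X.Fun p) :
    pairing g hk ψ (courantD ρ g hg f) = (-1 : ℝ) ^ (ℓ + p) • (hatAnchor ρ ψ).app hk' f := by
  rw [hg.symm hk (by omega)]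
  unfold courantD
  rw [LinearMap.comp_apply, pairing_coanchor_left ρ g hg _ _ rfl (by omega), extD_app _ _ hk']
  unfold hatAnchor
  rw [GDer.smul_app, smul_smul, smul_smul, smul_smul, sign_mul, sign_mul, sign_mul]
  congr 1
  apply sign_congr
  simp only [Int.even_add, Int.even_mul, Int.even_sub, Int.not_even_one]
  tauto

theorem courantD_mul (ρ : AnchorMap E ℓ) (g : MetricMap E ℓ) (hg : IsMetric g)
    {p q n : ℤ} (h : p + q = n) (h' : q + p = n) (f : X.Fun p) (f' : X.Fun q) :
    courantD ρ g hg (GCAlg.mul h f f' : X.Fun n)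
      = (-1 : ℝ) ^ p • GMod.smul h f (courantD ρ g hg f')
        + (-1 : ℝ) ^ (q + p * q) • GMod.smul h' f' (courantD ρ g hg f) := by
  -- It suffices to prove the product rule for d: ρ* is linear of degree zero and adds no sign.
  -- Graded commutativity moves f' to the front of Y(f)f'.
  have key : (extD (GCAlg.mul h f f' : X.Fun n) : OneForm X.Fun n)
      = (-1 : ℝ) ^ p • GMod.smul h f (extD f')
        + (-1 : ℝ) ^ (q + p * q) • GMod.smul h' f' (extD f) := by
    apply GHom.ext
    intro i j hij Y
    rw [GHom.add_app, GHom.smul_app, GHom.smul_app, GHom.gsmul_app h _ _ _ rfl (by omega),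
      GHom.gsmul_app h' _ _ _ rfl (by omega), extD_app _ _ (by omega), extD_app _ _ (by omega),
      extD_app _ _ (by omega), map_smul, map_smul,
      Y.leibniz h (by omega) (by omega : p + i = i + p) (by omega) (by omega : q + i = i + q)
        (by omega), GCAlg.mul_comm (by omega) (by omega) _ f', smul_add, smul_smul, smul_smul,
      smul_smul, smul_smul, add_comm]
    simp only [sign_mul]
    congr 1
    · congr 1
      apply sign_congr
      subst h
      simp only [Int.even_add, Int.even_mul, Int.even_sub, Int.not_even_one]
      tauto
    · congr 1
      apply sign_congr
      subst h
      simp only [Int.even_add, Int.even_mul, Int.even_sub, Int.not_even_one]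
      tauto
  unfold courantD
  rw [LinearMap.comp_apply, key, map_add, map_smul, map_smul,
    GHom.map_gsmul _ h (add_zero n) (add_zero q) h, GHom.map_gsmul _ h' (add_zero n) (add_zero p) h',
    mul_zero, mul_zero, zpow_zero, one_smul, one_smul]
  rfl

end Bundles


/-! ### Bump functions, gluing, and faithfulness of the action on global sections -/

/-- The function of degree zero on a graded domain given by a smooth function. -/
def GradedDim.ofSmooth (n : GradedDim) {V : Opens n.Space} (f : n.Smooth V) : n.Fn V 0 :=
  ⟨fun p => if p = 0 then f else 0, by
    intro p hp
    refine if_neg ?_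
    rintro rfl
    exact hp ⟨by simp, by simp⟩⟩

theorem GradedDim.res_ofSmooth (n : GradedDim) {V W : Opens n.Space} (h : W ≤ V)
    (f : n.Smooth V) : n.res h (n.ofSmooth f)
      = n.ofSmooth (ContMDiffMap.restrictRingHom (𝓡 n.dim₀) 𝓘(ℝ, ℝ) ℝ h f) := by
  apply Subtype.ext
  funext p
  change ContMDiffMap.restrictRingHom (𝓡 n.dim₀) 𝓘(ℝ, ℝ) ℝ h (if p = 0 then f else 0) = _
  rw [apply_ite (ContMDiffMap.restrictRingHom (𝓡 n.dim₀) 𝓘(ℝ, ℝ) ℝ h), map_zero]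
  rfl

theorem GradedDim.ofSmooth_one (n : GradedDim) {V : Opens n.Space} :
    n.ofSmooth (1 : n.Smooth V) = n.one V := rfl

theorem GradedDim.ofSmooth_zero (n : GradedDim) {V : Opens n.Space} :
    n.ofSmooth (0 : n.Smooth V) = 0 := by
  apply Subtype.ext
  funext p
  exact ite_self _

section Bundles

variable {M : Type u} [TopologicalSpace M]

/-- An ordinary bump in the degree-zero coordinates of a chart, pulled back. The set N is a second
member of an open cover, on whose overlap with W the bump vanishes, so that products with b can be
glued to zero on N. -/
theorem GradedManifold.exists_bump (X : GradedManifold.{u, v} M) (m : M) (U : Opens M)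
    (hm : m ∈ U) : ∃ (W W' N : Opens M) (_ : W ≤ U) (hW' : W' ≤ W) (b : X.Fn W 0), m ∈ W' ∧
      X.res hW' b = GCAlg.one ∧ W ⊔ N = ⊤ ∧ X.res (inf_le_left : W ⊓ N ≤ W) b = 0 := by
  obtain ⟨c, hc⟩ := X.exists_chart m
  have := X.t2
  let V : Opens X.gdim.Space := ⟨c.φ.target ∩ c.φ.symm ⁻¹' U, c.φ.isOpen_inter_preimage_symm U.2⟩
  have hV : (V : Set X.gdim.Space) ⊆ c.φ.target := Set.inter_subset_left
  have hx : c.φ m ∈ (V : Set X.gdim.Space) := by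
    refine ⟨c.φ.map_source hc, ?_⟩
    rw [Set.mem_preimage, c.φ.left_inv hc]
    exact hm
  obtain ⟨r, hr, hrV⟩ := Metric.nhds_basis_closedBall.mem_iff.1 (V.2.mem_nhds hx)
  let β : ContDiffBump (c.φ m) := ⟨r / 2, r, half_pos hr, half_lt_self hr⟩
  let βV : X.gdim.Smooth V :=
    ⟨fun y => β y, β.contDiff.contMDiff.comp contMDiff_subtype_val⟩
  let B : Opens X.gdim.Space := ⟨Metric.ball (c.φ m) (r / 2), Metric.isOpen_ball⟩
  have hB : B ≤ V := fun y hy =>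
    hrV (Metric.ball_subset_closedBall (Metric.ball_subset_ball (half_le_self hr.le) hy))
  let Z : Opens X.gdim.Space := ⟨V \ Metric.closedBall (c.φ m) r,
    V.2.sdiff Metric.isClosed_closedBall⟩
  have hZ : Z ≤ V := fun y hy => hy.1
  let K : Set M := c.φ.symm '' Metric.closedBall (c.φ m) r
  -- The closed ball lies in the chart image, so its preimage is compact, hence closed in the
  -- Hausdorff space M; this makes its complement N open in all of M.
  have hK : IsCompact K := (isCompact_closedBall _ _).image_of_continuousOn
    (c.φ.continuousOn_symm.mono (hrV.trans hV))
  let N : Opens M := ⟨Kᶜ, hK.isClosed.isOpen_compl⟩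
  have hsub : preimageOpens c.φ V ⊓ N ≤ preimageOpens c.φ Z := by
    rintro y ⟨⟨hy, hyV⟩, hyN⟩
    refine ⟨hy, hyV, fun h => hyN ⟨c.φ y, h, c.φ.left_inv hy⟩⟩
  refine ⟨preimageOpens c.φ V, preimageOpens c.φ B, N, ?_, preimageOpens_mono c.φ hB,
    c.pullback V hV 0 (X.gdim.ofSmooth βV), ⟨hc, Metric.mem_ball_self (half_pos hr)⟩, ?_, ?_, ?_⟩
  · rintro y ⟨hy, hyV⟩
    have := hyV.2
    rw [Set.mem_preimage, c.φ.left_inv hy] at this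
    exact this
  · rw [← c.pullback_res V B hV (fun y hy => hV (hB hy)) hB, GradedDim.res_ofSmooth,
      ← c.pullback_one B (fun y hy => hV (hB hy)), ← GradedDim.ofSmooth_one]
    congr 2
    exact ContMDiffMap.ext fun y =>
      β.one_of_mem_closedBall (Metric.ball_subset_closedBall y.2)
  · rw [eq_top_iff]
    intro y _
    by_cases hy : y ∈ K
    · left
      obtain ⟨z, hz, rfl⟩ := hy
      refine ⟨c.φ.map_target (hV (hrV hz)), ?_⟩
      rw [Set.mem_preimage, c.φ.right_inv (hV (hrV hz))]
      exact hrV hz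
    · exact Or.inr hy
  · rw [← X.res_res (preimageOpens_mono c.φ hZ) hsub,
      ← c.pullback_res V Z hV (fun y hy => hV (hZ hy)) hZ, GradedDim.res_ofSmooth]
    have : ContMDiffMap.restrictRingHom (𝓡 X.gdim.dim₀) 𝓘(ℝ, ℝ) ℝ hZ βV = 0 := by
      apply ContMDiffMap.ext
      intro y
      exact β.zero_of_le_dist (not_le.1 y.2.2).le
    rw [this, GradedDim.ofSmooth_zero, map_zero, map_zero]

theorem GCAlgSheaf.eq_zero_of_locally (S : GCAlgSheaf.{u, v} M) {i : ℤ} (f : S.Fn ⊤ i)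
    (H : ∀ m : M, ∃ U : Opens M, m ∈ U ∧ S.res (le_top : U ≤ ⊤) f = 0) : f = 0 := by
  choose U hU hf using H
  have hcov : (⊤ : Opens M) ≤ ⨆ m, U m := fun m _ => Opens.mem_iSup.2 ⟨m, hU m⟩
  obtain ⟨t, -, ht⟩ := S.glue U i (fun m => (0 : S.Fn (U m) i)) (by intro a b; simp)
  have h : S.res (le_top : ⨆ m, U m ≤ ⊤) f = 0 := by
    exact (ht _ (fun a => by rw [S.res_res]; exact hf a)).trans (ht 0 (fun a => map_zero _)).symm
  -- The supremum of the cover equals ⊤ only propositionally; restricting from ⊤ to it and back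
  -- avoids transporting sections along that equality.
  rw [← S.res_self f, ← S.res_res le_top hcov, h, map_zero]

variable {X : GradedManifold.{u, v} M} (E : GradedVectorBundle.{u, v, w} X)

theorem GradedVectorBundle.eq_zero_of_locally {i : ℤ} (s : E.Γ i)
    (H : ∀ m : M, ∃ U : Opens M, m ∈ U ∧ E.res (le_top : U ≤ ⊤) s = 0) : s = 0 := by
  choose U hU hs using H
  have hcov : (⊤ : Opens M) ≤ ⨆ m, U m := fun m _ => Opens.mem_iSup.2 ⟨m, hU m⟩
  obtain ⟨t, -, ht⟩ := E.glue U i (fun m => (0 : E.Sec (U m) i)) (by intro a b; simp)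
  have h : E.res (le_top : ⨆ m, U m ≤ ⊤) s = 0 := by
    exact (ht _ (fun a => by rw [E.res_res]; exact hs a)).trans (ht 0 (fun a => map_zero _)).symm
  rw [← E.res_self s, ← E.res_res le_top hcov, h, map_zero]

theorem GradedVectorBundle.exists_extension_by_zero {W N : Opens M} (h : W ⊔ N = ⊤) {i : ℤ}
    (s : E.Sec W i) (hs : E.res (inf_le_left : W ⊓ N ≤ W) s = 0) :
    ∃ t : E.Γ i, E.res (le_top : W ≤ ⊤) t = s := by
  -- `ULift` is needed because the gluing axiom takes index types in the universe of M.
  let U : ULift.{u} Bool → Opens M := fun a => cond a.down W N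
  let σ : ∀ a, E.Sec (U a) i := fun a => match a with
    | ⟨true⟩ => s
    | ⟨false⟩ => (0 : E.Sec N i)
  obtain ⟨t, ht, -⟩ := E.glue U i σ (by
    rintro ⟨_ | _⟩ ⟨_ | _⟩
    · rfl
    · change E.res (inf_le_left : N ⊓ W ≤ N) (0 : E.Sec N i) = E.res (inf_le_right : N ⊓ W ≤ W) s
      rw [map_zero, ← E.res_res inf_le_left (le_of_eq (inf_comm N W)), hs, map_zero]
    · change E.res (inf_le_left : W ⊓ N ≤ W) s = E.res (inf_le_right : W ⊓ N ≤ N) (0 : E.Sec N i)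
      rw [map_zero, hs]
    · rfl)
  have hcov : (⊤ : Opens M) ≤ ⨆ a, U a := by
    rw [← h]
    exact sup_le (le_iSup U ⟨true⟩) (le_iSup U ⟨false⟩)
  refine ⟨E.res hcov t, ?_⟩
  rw [E.res_res]
  exact ht ⟨true⟩

variable {E}

/-- In rank zero all sections vanish locally, hence globally. Otherwise h kills a global section
that agrees near m with a frame element, and uniqueness of frame coordinates forces h = 0 near m. -/
theorem eq_zero_or_of_gsmul_eq_zero {p : ℤ} (h : X.Fun p)
    (H : ∀ (j k : ℤ) (hk : p + j = k) (ψ : E.Γ j), (GMod.smul hk h ψ : E.Γ k) = 0) :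
    h = 0 ∨ ∀ (j : ℤ) (ψ : E.Γ j), ψ = 0 := by
  rcases isEmpty_or_nonempty (Fin E.rank) with h0 | ⟨⟨a⟩⟩
  · right
    intro j ψ
    apply E.eq_zero_of_locally
    intro m
    obtain ⟨U, Φ, hm, hΦ⟩ := E.exists_frame m
    obtain ⟨f, hf, -⟩ := hΦ U le_rfl j (E.res le_top ψ)
    exact ⟨U, hm, by rw [hf, Fintype.sum_empty]⟩
  · left
    -- Puts the degree of h in the form that the frame axiom gives to the a-th coordinate of a
    -- section of degree k.
    obtain ⟨k, rfl⟩ : ∃ k, p = k - E.frameDeg a := ⟨p + E.frameDeg a, by omega⟩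
    apply X.eq_zero_of_locally
    intro m
    obtain ⟨U, Φ, hm, hΦ⟩ := E.exists_frame m
    obtain ⟨W, W', N, hW, hW', b, hm', hb1, hcov, hb0⟩ := X.exists_bump m U hm
    obtain ⟨t, ht⟩ := E.exists_extension_by_zero hcov
      (GMod.smul (zero_add (E.frameDeg a)) b (E.res hW (Φ a)))
      (by rw [E.res_smul, hb0, map_zero, LinearMap.zero_apply])
    refine ⟨W', hm', ?_⟩
    have ht' : E.res (le_top : W' ≤ ⊤) t = E.res (hW'.trans hW) (Φ a) := by
      rw [← E.res_res le_top hW', ht, E.res_smul, hb1, GMod.one_smul, E.res_res]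
    have h0 : (GMod.smul (sub_add_cancel k (E.frameDeg a)) (X.res (le_top : W' ≤ ⊤) h)
        (E.res (hW'.trans hW) (Φ a)) : E.Sec W' k) = 0 := by
      rw [← ht', ← E.res_smul, H, map_zero]
    obtain ⟨f, -, hf⟩ := hΦ W' (hW'.trans hW) k 0
    -- The tuple with sole entry h in place a and the zero tuple both expand the zero section, so
    -- they coincide.
    have e1 := hf (Pi.single a (X.res (le_top : W' ≤ ⊤) h)) (by
      beta_reduce
      rw [Finset.sum_eq_single a, Pi.single_eq_same, h0]
      · intro c _ hc
        rw [Pi.single_eq_of_ne hc, map_zero, LinearMap.zero_apply]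
      · simp)
    have e2 := hf 0 (by simp)
    have := congrFun (e1.trans e2.symm) a
    rwa [Pi.single_eq_same] at this

end Bundles


/-! ### Linearity of the pairing and of ρ̂ -/

section Bundles

variable {M : Type u} [TopologicalSpace M]
variable {X : GradedManifold.{u, v} M} {E : GradedVectorBundle.{u, v, w} X} {ℓ : ℤ}

theorem gsmul_eq_mul {A : ℤ → Type v} [∀ i, AddCommGroup (A i)] [∀ i, Module ℝ (A i)] [GCAlg A]
    {i j k : ℤ} (h : i + j = k) (a : A i) (b : A j) : (GMod.smul h a b : A k) = GCAlg.mul h a b :=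
  rfl

theorem eq_or_of_gsmul_eq {p : ℤ} (a b : X.Fun p)
    (H : ∀ (j k : ℤ) (hk : p + j = k) (ψ : E.Γ j),
      (GMod.smul hk a ψ : E.Γ k) = GMod.smul hk b ψ) :
    a = b ∨ ∀ (j : ℤ) (ψ : E.Γ j), ψ = 0 := by
  rw [← sub_eq_zero]
  apply eq_zero_or_of_gsmul_eq_zero
  intro j k hk ψ
  rw [map_sub, LinearMap.sub_apply, H, sub_self]

theorem pairing_add_left (g : MetricMap E ℓ) {i j k : ℤ} (h : i + j + ℓ = k) (ψ φ : E.Γ i)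
    (ψ' : E.Γ j) : pairing g h (ψ + φ) ψ' = pairing g h ψ ψ' + pairing g h φ ψ' :=
  (pairingₗ g h).map_add₂ ψ φ ψ'

theorem pairing_smul_left (g : MetricMap E ℓ) {i j k : ℤ} (h : i + j + ℓ = k) (c : ℝ) (ψ : E.Γ i)
    (ψ' : E.Γ j) : pairing g h (c • ψ) ψ' = c • pairing g h ψ ψ' :=
  (pairingₗ g h).map_smul₂ c ψ ψ'

theorem pairing_smul_right (g : MetricMap E ℓ) {i j k : ℤ} (h : i + j + ℓ = k) (c : ℝ) (ψ : E.Γ i)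
    (ψ' : E.Γ j) : pairing g h ψ (c • ψ') = c • pairing g h ψ ψ' :=
  (pairingₗ g h ψ).map_smul c ψ'

theorem hatAnchor_add (ρ : AnchorMap E ℓ) {i : ℤ} (ψ φ : E.Γ i) :
    hatAnchor ρ (ψ + φ) = hatAnchor ρ ψ + hatAnchor ρ φ := by
  unfold hatAnchor
  rw [map_add, smul_add]

theorem hatAnchor_smul (ρ : AnchorMap E ℓ) {i : ℤ} (c : ℝ) (ψ : E.Γ i) :
    hatAnchor ρ (c • ψ) = c • hatAnchor ρ ψ := by
  unfold hatAnchor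
  rw [map_smul, smul_comm]

theorem hatAnchor_zero (ρ : AnchorMap E ℓ) {i : ℤ} : hatAnchor ρ (0 : E.Γ i) = 0 := by
  unfold hatAnchor
  rw [map_zero, smul_zero]

theorem hatAnchor_zero_app (ρ : AnchorMap E ℓ) {i p k : ℤ} (h : p + (i + ℓ) = k) (f : X.Fun p) :
    (hatAnchor ρ (0 : E.Γ i)).app h f = 0 := by
  rw [hatAnchor_zero]
  rfl

theorem hatAnchor_gsmul_app (ρ : AnchorMap E ℓ) {p i m q r s : ℤ} (h : p + i = m)
    (hr : q + (m + ℓ) = r) (hs : q + (i + ℓ) = s) (hr' : p + s = r) (f : X.Fun p) (ψ : E.Γ i)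
    (f' : X.Fun q) :
    (hatAnchor ρ (GMod.smul h f ψ)).app hr f' = GCAlg.mul hr' f ((hatAnchor ρ ψ).app hs f') := by
  unfold hatAnchor
  rw [ρ.map_gsmul h rfl rfl (by omega), GDer.smul_app, GDer.smul_app, GDer.smul_app,
    GDer.gsmul_app _ _ _ _ hs hr', map_smul, smul_smul, sign_mul]
  congr 1
  apply sign_congr
  subst h
  simp only [Int.even_add, Int.even_mul]
  tauto

/-! ### Consequences of the Courant algebroid axioms -/

namespace GradedCourantAlgebroid

variable (C : GradedCourantAlgebroid E ℓ)

theorem bracket_gsmul {i j p q m n k : ℤ} (hq : p + j = q) (hk : i + q + ℓ = k)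
    (hm : p + (i + ℓ) = m) (hmk : m + j = k) (hn : i + j + ℓ = n) (hnk : p + n = k)
    (ψ : E.Γ i) (f : X.Fun p) (ψ' : E.Γ j) :
    C.bracket hk ψ (GMod.smul hq f ψ')
      = GMod.smul hmk ((C.ρhat ψ).app hm f) ψ'
        + (-1 : ℝ) ^ (p * (i + ℓ)) • GMod.smul hnk f (C.bracket hn ψ ψ') := by
  apply eq_of_pairing_right C.g C.isMetric
  intro l r hr ψ''
  -- Invariance for fψ', then for ψ'. After the derivation rule and substitution of the second
  -- identity, both sides share the term in ⟨ψ',[ψ,ψ'']⟩, which cancels.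
  have h₁ := C.pairing_comp (p := q + l + ℓ) (s := i + l + ℓ) rfl (by omega) hk hr rfl (by omega)
    ψ (GMod.smul hq f ψ') ψ''
  have h₂ := C.pairing_comp (p := j + l + ℓ) (s := i + l + ℓ) (r := n + l + ℓ) rfl (by omega) hn
    rfl rfl (by omega) ψ ψ' ψ''
  rw [pairing_gsmul_left C.g hq rfl rfl (by omega),
    pairing_gsmul_left C.g hq _ (by omega : j + (i + l + ℓ) + ℓ = n + l + ℓ) (by omega),
    gsmul_eq_mul, gsmul_eq_mul,
    GDer.leibniz _ _ _ hm (by omega) (by omega : _ = n + l + ℓ) (by omega), h₂, map_add, map_smul,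
    show (-1 : ℝ) ^ ((i + ℓ) * (q + ℓ))
      = (-1 : ℝ) ^ (p * (i + ℓ)) * (-1 : ℝ) ^ ((i + ℓ) * (j + ℓ)) by
      rw [sign_mul, ← hq]; congr 1; ring,
    mul_comm (i + ℓ) p, smul_add, smul_smul, ← add_assoc, add_left_inj] at h₁
  rw [← h₁, pairing_add_left, pairing_smul_left, pairing_gsmul_left C.g hmk hr rfl (by omega),
    pairing_gsmul_left C.g hnk hr rfl (by omega)]
  rfl

theorem hatAnchor_bracket_app {i j k p m n n' : ℤ} (hk : i + j + ℓ = k) (hm : p + (k + ℓ) = m)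
    (hn : p + (j + ℓ) = n) (hnm : n + (i + ℓ) = m) (hn' : p + (i + ℓ) = n')
    (hnm' : n' + (j + ℓ) = m) (ψ : E.Γ i) (ψ' : E.Γ j) (f : X.Fun p) :
    (C.ρhat (C.bracket hk ψ ψ')).app hm f
      = (C.ρhat ψ).app hnm ((C.ρhat ψ').app hn f)
        - (-1 : ℝ) ^ ((i + ℓ) * (j + ℓ)) • (C.ρhat ψ').app hnm' ((C.ρhat ψ).app hn' f) := by
  refine (eq_or_of_gsmul_eq (E := E) ((C.ρhat (C.bracket hk ψ ψ')).app hm f)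
    ((C.ρhat ψ).app hnm ((C.ρhat ψ').app hn f)
      - (-1 : ℝ) ^ ((i + ℓ) * (j + ℓ)) • (C.ρhat ψ').app hnm' ((C.ρhat ψ).app hn' f)) ?_).elim
    id fun h => ?_
  swap
  -- Degenerate case: without nonzero sections, ψ and ψ' are themselves zero.
  · rw [h _ ψ, h _ ψ']
    simp only [hatAnchor_zero_app, map_zero, smul_zero, sub_zero]
  intro l r hr ψ''
  have h₁ := C.jacobi (p := n + l) (q := k) (r := n' + l) (by omega) (by omega : _ = r) hk
    (by omega) (by omega) (by omega) ψ ψ' (GMod.smul rfl f ψ'')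
  have h₂ := C.jacobi (p := j + l + ℓ) (q := k) (r := i + l + ℓ) (s := k + l + ℓ) rfl (by omega)
    hk rfl rfl (by omega) ψ ψ' ψ''
  rw [C.bracket_gsmul rfl _ hn rfl (rfl : j + l + ℓ = _) (by omega),
    C.bracket_gsmul rfl _ hn' rfl (rfl : i + l + ℓ = _) (by omega),
    C.bracket_gsmul rfl _ hm hr (rfl : k + l + ℓ = _) (by omega), map_add, map_add, map_smul,
    map_smul, C.bracket_gsmul rfl _ hnm hr (rfl : i + l + ℓ = _) (by omega),
    C.bracket_gsmul rfl _ hnm' hr (rfl : j + l + ℓ = _) (by omega),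
    C.bracket_gsmul _ _ hn' (by omega) (by omega : _ = k + l + ℓ) (by omega),
    C.bracket_gsmul _ _ hn (by omega) (by omega : _ = k + l + ℓ) (by omega), h₂, map_add,
    map_smul,
    show (-1 : ℝ) ^ (n * (i + ℓ)) = (-1 : ℝ) ^ (p * (i + ℓ)) * (-1 : ℝ) ^ ((i + ℓ) * (j + ℓ)) by
      rw [sign_mul, ← hn]; congr 1; ring,
    show (-1 : ℝ) ^ (n' * (j + ℓ)) = (-1 : ℝ) ^ (p * (j + ℓ)) * (-1 : ℝ) ^ ((i + ℓ) * (j + ℓ)) by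
      rw [sign_mul, ← hn']; congr 1; ring,
    show (-1 : ℝ) ^ (p * (k + ℓ)) = (-1 : ℝ) ^ (p * (i + ℓ)) * (-1 : ℝ) ^ (p * (j + ℓ)) by
      rw [sign_mul, ← hk]; congr 1; ring] at h₁
  -- The square of the exchange sign is 1. This is needed only for the mixed term (ρ̂(ψ)f)[ψ',ψ''],
  -- which acquires the sign twice on the right; the other mixed term cancels identically.
  have hc := (sign_mul ((i + ℓ) * (j + ℓ)) ((i + ℓ) * (j + ℓ))).trans
    (Even.neg_one_zpow ⟨_, rfl⟩)
  rw [map_sub, map_smul, LinearMap.sub_apply, LinearMap.smul_apply]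
  generalize (-1 : ℝ) ^ ((i + ℓ) * (j + ℓ)) = c at *
  generalize (-1 : ℝ) ^ (p * (i + ℓ)) = a at *
  generalize (-1 : ℝ) ^ (p * (j + ℓ)) = b at *
  linear_combination (norm := module)
    -(hc • b • (GMod.smul (by omega) ((C.ρhat ψ).app hn' f)
      (C.bracket (k := j + l + ℓ) rfl ψ' ψ'') : E.Γ r)) - h₁

/-- ρ̂ turns the symmetrized bracket into a symmetrized graded commutator, which is zero. -/
theorem hatAnchor_courantD_pairing {i j k : ℤ} (h : i + j + ℓ = k) (ψ : E.Γ i) (ψ' : E.Γ j) :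
    C.ρhat (C.D (C.pair h ψ ψ')) = 0 := by
  have h₁ := congrArg (hatAnchor C.ρ) (C.skew_symm h (by omega) ψ ψ')
  rw [hatAnchor_smul, hatAnchor_add, hatAnchor_smul] at h₁
  rw [← sign_smul_eq_zero, ← h₁]
  apply GDer.ext
  intro p m hm f
  rw [GDer.add_app, GDer.smul_app, C.hatAnchor_bracket_app h hm rfl (by omega) rfl (by omega),
    C.hatAnchor_bracket_app _ hm rfl (by omega) rfl (by omega), smul_sub, mul_comm (j + ℓ),
    sign_smul_sign_smul, sub_add_sub_cancel, sub_self]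
  rfl

theorem hatAnchor_courantD {p : ℤ} (f : X.Fun p) : C.ρhat (C.D f) = 0 := by
  apply GDer.ext
  intro q r hr f'
  change _ = 0
  refine (eq_zero_or_of_gsmul_eq_zero (E := E) ((C.ρhat (C.D f)).app hr f') ?_).elim id fun h => ?_
  swap
  · rw [h _ (C.D f)]
    exact hatAnchor_zero_app _ _ _
  intro i k hk ψ
  apply eq_zero_of_pairing_right C.g C.isMetric
  intro j m hm ψ'
  -- Expanding D(f⟨ψ,ψ'⟩) under ρ̂, the term f ρ̂(D⟨ψ,ψ'⟩) vanishes by the previous lemma, so only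
  -- ⟨ψ,ψ'⟩ρ̂(Df) survives; evaluated on f', this is up to sign the pairing of (ρ̂(Df)f')ψ with ψ'.
  have h₁ := C.hatAnchor_courantD_pairing (i := p + i) (k := p + (i + j + ℓ)) (by omega)
    (GMod.smul rfl f ψ) ψ'
  rw [pair, pairing_gsmul_left C.g rfl _ rfl rfl, gsmul_eq_mul, D,
    courantD_mul C.ρ C.g C.isMetric rfl (by omega), ρhat, hatAnchor_add, hatAnchor_smul, hatAnchor_smul]
    at h₁
  have h₂ : GDer.app _ (by omega : q + (p + (i + j + ℓ) + ℓ) = m) f' = 0 := congrArg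
    (fun Y : X.VecField _ => Y.app (by omega : q + (p + (i + j + ℓ) + ℓ) = m) f') h₁
  rw [GDer.add_app, GDer.smul_app, GDer.smul_app,
    hatAnchor_gsmul_app _ _ _ rfl (by omega), hatAnchor_gsmul_app _ _ _ hr (by omega),
    show hatAnchor C.ρ (courantD C.ρ C.g C.isMetric (pairing C.g _ ψ ψ')) = 0 from
      C.hatAnchor_courantD_pairing rfl ψ ψ'] at h₂
  change _ • GCAlg.mul _ _ 0 + _ = (0 : X.Fun m) at h₂
  rw [map_zero, smul_zero, zero_add, sign_smul_eq_zero] at h₂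
  rw [pairing_gsmul_left C.g hk hm rfl (by omega), gsmul_eq_mul, GCAlg.mul_comm _ (by omega), h₂,
    smul_zero]

theorem anchor_courantD {p m : ℤ} (h : p + ℓ = m) (f : X.Fun p) : C.ρ.app h (C.D f) = 0 := by
  subst h
  exact sign_smul_eq_zero.1 (C.hatAnchor_courantD f)

/-- Compute ⟨ρ*α, Df⟩ twice: it is ±α(ρ(Df)) = 0, and also ±ρ̂(ρ*α)(f). This covers every one-form,
without any claim that exact ones generate. -/
theorem anchor_coanchor {p q m : ℤ} (h : p + 0 = q) (hm : q + ℓ = m) (α : OneForm X.Fun p) :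
    C.ρ.app hm (C.ρstar.app h α) = 0 := by
  subst hm
  apply GDer.ext
  intro r s hs f
  have h₁ := pairing_courantD_right C.ρ C.g C.isMetric (by omega) hs (C.ρstar.app h α) f
  rw [pairing_coanchor_left C.ρ C.g C.isMetric h _ rfl (by omega)] at h₁
  have h₂ := C.anchor_courantD rfl f
  rw [D] at h₂
  rw [h₂, map_zero, smul_zero, eq_comm, sign_smul_eq_zero] at h₁
  exact sign_smul_eq_zero.1 h₁

/-- Invariance for (ψ, ψ', Df) becomes a statement about ρ̂ acting on f. The homomorphism property
cancels ρ̂(ψ)ρ̂(ψ')f, leaving ρ̂(ψ')ρ̂(ψ)f, which is ±⟨ψ', D⟨ψ,Df⟩⟩. -/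
theorem bracket_courantD {i p k : ℤ} (h : i + p + ℓ = k) (ψ : E.Γ i) (f : X.Fun p) :
    C.bracket h ψ (C.D f) = (-1 : ℝ) ^ (i + p) • C.D (C.pair h ψ (C.D f)) := by
  apply eq_of_pairing_left C.g C.isMetric
  intro j r hr ψ'
  have h₁ := C.pairing_comp (p := j + p + ℓ) rfl (by omega) (q := i + j + ℓ) rfl (by omega) h hr
    ψ ψ' (C.D f)
  rw [pairing_courantD_right C.ρ C.g C.isMetric _ (by omega),
    pairing_courantD_right C.ρ C.g C.isMetric _ (by omega),
    C.hatAnchor_bracket_app rfl _ (by omega : _ = j + p + ℓ) (by omega) (by omega : _ = k)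
      (by omega), map_smul, smul_sub, sub_add_eq_add_sub, eq_comm, sub_eq_iff_eq_add,
      add_right_inj] at h₁
  rw [pairing_smul_right, pairing_courantD_right C.ρ C.g C.isMetric _ (by omega), pair,
    pairing_courantD_right C.ρ C.g C.isMetric _ (by omega),
    ← sign_smul_sign_smul ((i + ℓ) * (j + ℓ)) (pairing C.g hr ψ' _), h₁, map_smul, smul_comm _
      ((-1 : ℝ) ^ (ℓ + p)), sign_smul_sign_smul, smul_smul, smul_smul, sign_mul, sign_mul]
  congr 1
  apply sign_congr
  subst h
  simp only [Int.even_add]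
  tauto

theorem courantD_bracket {i p k : ℤ} (h : p + i + ℓ = k) (ψ : E.Γ i) (f : X.Fun p) :
    C.bracket h (C.D f) ψ = 0 := by
  have h₁ := C.skew_symm (by omega) h ψ (C.D f)
  rwa [C.bracket_courantD, add_eq_left, sign_smul_eq_zero] at h₁

theorem anchor_bracket {i j k m n l : ℤ} (hk : i + j + ℓ = k) (hm : k + ℓ = m) (hn : i + ℓ = n)
    (hl : j + ℓ = l) (h : n + l = m) (ψ : E.Γ i) (ψ' : E.Γ j) :
    C.ρ.app hm (C.bracket hk ψ ψ') = GDer.commutator h (C.ρ.app hn ψ) (C.ρ.app hl ψ') := by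
  subst hm hn hl
  apply GDer.ext
  intro p q hq f
  have h₁ := C.hatAnchor_bracket_app hk hq rfl (by omega) rfl (by omega) ψ ψ' f
  unfold ρhat hatAnchor at h₁
  simp only [GDer.smul_app, map_smul] at h₁
  -- Passing from ρ̂ to ρ: the prefactors of ψ and ψ' multiply to that of [ψ,ψ'], since the degrees
  -- shifted by ℓ add up, and this common sign cancels.
  rw [smul_comm ((-1 : ℝ) ^ ((i + ℓ) * (j + ℓ))), smul_comm ((-1 : ℝ) ^ ((i + ℓ) * (j + ℓ))),
    smul_comm ((-1 : ℝ) ^ ((j + ℓ) * ℓ)), ← smul_sub, ← smul_sub, smul_smul, sign_mul,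
    show (i + ℓ) * ℓ + (j + ℓ) * ℓ = (k + ℓ) * ℓ by rw [← h]; ring] at h₁
  rw [GDer.commutator_app h _ _ hq rfl (by omega) rfl (by omega)]
  exact smul_right_injective _ (zpow_ne_zero _ (by norm_num)) h₁

end GradedCourantAlgebroid

end Bundles

end GradedGeometry

end

theorem mainTheorem5 {M : Type u} [TopologicalSpace M] (X : GradedManifold.{u, v} M)
    (E : GradedVectorBundle.{u, v, w} X) (ℓ : ℤ) (C : GradedCourantAlgebroid E ℓ) :
    -- the graded Leibniz rule
    (∀ (i j p : ℤ) (ψ : E.Γ i) (f : X.Fun p) (ψ' : E.Γ j),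
      C.bracket (k := i + (p + j) + ℓ) rfl ψ (GMod.smul (k := p + j) rfl f ψ')
        = GMod.smul (by omega) ((C.ρhat ψ).app (j := p + (i + ℓ)) rfl f) ψ'
          + (-1 : ℝ) ^ (p * (i + ℓ)) •
            GMod.smul (by omega) f (C.bracket (k := i + j + ℓ) rfl ψ ψ')) ∧
    -- the anchor is a bracket homomorphism
    (∀ (i j : ℤ) (ψ : E.Γ i) (ψ' : E.Γ j),
      C.ρ.app (j := i + j + ℓ + ℓ) rfl (C.bracket (k := i + j + ℓ) rfl ψ ψ')
        = GDer.commutator (by omega) (C.ρ.app (j := i + ℓ) rfl ψ)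
            (C.ρ.app (j := j + ℓ) rfl ψ')) ∧
    -- `ρ ∘ D = 0`
    (∀ (p : ℤ) (f : X.Fun p), C.ρ.app (j := p + ℓ) rfl (C.D f) = 0) ∧
    -- `ρ ∘ ρ* = 0`
    (GHom.comp (n := ℓ) (by omega) C.ρ C.ρstar = 0) ∧
    -- `0 → T* M → E → T[ℓ] M → 0` is a complex of vector bundle maps of degree zero
    (GHom.comp (n := 0) (by omega) C.ρshift C.ρstar = 0) ∧
    -- `[ψ, Df] = (-1)^(|ψ| + |f|) D⟨ψ, Df⟩` and `[Df, ψ] = 0`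
    (∀ (i p : ℤ) (ψ : E.Γ i) (f : X.Fun p),
      C.bracket (k := i + p + ℓ) rfl ψ (C.D f)
        = (-1 : ℝ) ^ (i + p) • C.D (C.pair (k := i + p + ℓ) rfl ψ (C.D f))) ∧
    (∀ (i p : ℤ) (ψ : E.Γ i) (f : X.Fun p),
      C.bracket (k := p + i + ℓ) rfl (C.D f) ψ = 0) := by
  refine ⟨fun i j p ψ f ψ' => C.bracket_gsmul rfl rfl rfl (by omega) rfl (by omega) ψ f ψ',
    fun i j ψ ψ' => C.anchor_bracket rfl rfl rfl rfl (by omega) ψ ψ',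
    fun p f => C.anchor_courantD rfl f, ?_, ?_, fun i p ψ f => C.bracket_courantD rfl ψ f,
    fun i p ψ f => C.courantD_bracket rfl ψ f⟩
  · apply GHom.ext
    intro i j h α
    rw [GHom.comp_app _ _ _ _ (add_zero i) h]
    exact C.anchor_coanchor _ _ α
  · apply GHom.ext
    intro i j h α
    rw [GHom.comp_app _ _ _ _ (add_zero i) h]
    exact C.anchor_coanchor (add_zero i) (show i + ℓ = j + ℓ by rw [← h, add_zero]) α
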